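/- Let $k$ be a field and let $H$ be a ribbon Hopf algebra over $k$: a Hopf algebra with an invertible universal $R$-matrix $R=\sum_i a_i\otimes b_i\in H\otimes H$ (so $R\,\Delta(h)=\Delta^{op}(h)\,R$ for all $h$, $(\Delta\otimes\mathrm{id})R=R_{13}R_{23}$, $(\mathrm{id}\otimes\Delta)R=R_{13}R_{12}$) and an invertible central element $v$ with $v^2=u\,S(u)$ for $u=\sum_i S(b_i)a_i$, $S(v)=v$, $\varepsilon(v)=1$ and $R_{21}R\,\Delta(v)=v\otimes v$. The finite-dimensional $H$-modules carry the braiding $c_{X,Y}(x\otimes y)=\tau(R(x\otimes y))$, with $\tau$ the flip, the twist $\theta_X=v^{-1}$, the dual $X^*$ with action $(hf)(x)=f(S(h)x)$, the usual evaluation $\mathrm{ev}_X\colon X^*\otimes X\to k$ and coevaluation $\mathrm{coev}_X\colon k\to X\otimes X^*$, and the right-hand versions $\mathrm{ev}_X\circ c_{X,X^*}\circ(\theta_X\otimes\mathrm{id})$ and $(\mathrm{id}\otimes\theta_X)\circ c_{X,X^*}\circ\mathrm{coev}_X$. Framed oriented virtual tangles are the morphisms of the strict monoidal category whose objects are words on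 $\{+,-\}$ and whose morphisms are generated, with all possible orientations, by positive and negative crossings, virtual crossings, cups and caps, modulo planar isotopy, the Reidemeister moves for framed oriented tangles, the second and third virtual Reidemeister moves, and the mixed move sliding a strand with two virtual crossings past a crossing; no virtual first Reidemeister move is imposed. Framed oriented virtual links are the endomorphisms of the empty word. Classical framed oriented tangles and links are defined in the same way without virtual crossings. Let $V$ be a finite-dimensional $H$-module. For every classical link diagram $D$, let $F_V(D)\in\mathrm{End}_H(k)=k$ be its Reshetikhin--Turaev evaluation: $+\mapsto V$, $-\mapsto V^*$, crossings are sent to the braidings and their inverses, cups and caps to the (co)evaluations above. For every virtual link diagram $D$, let $G_V(D)\in\mathrm{End}_k(k)=k$ be obtained by the same rules in the category of vector spaces, with every virtual crossing sent to the flip. Then: (a) $G_V(D)$ depends only on the framed oriented virtual link presented by $D$, and so defines a $k$-valued invariant $Z_V$ of framed oriented virtual links; (b) $F_V(D)$ depends only on the framed oriented classical link presented by $D$, so defines a $k$-valued invariant $J_V$ (the Reshetikhin--Turaev invariant attached to $V$), and the restriction of $Z_V$ to classical links is $J_V$: $Z_V(L)=J_V(L)$ for every framed oriented classical link $L$, viewed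 as a virtual link. -/

import Mathlib

universe u w

open CategoryTheory MonoidalCategory TensorProduct

/-! ## Tangle diagrams -/

/-- The letters `+` and `-` of the words labelling the ends of oriented tangles. -/
inductive OrientationSign : Type
  | pos
  | neg

/-- Parenthesised words on `{+, -}`; `unit` is the empty word. -/
inductive TangleWord : Type
  | unit
  | letter (a : OrientationSign)
  | tensor (X Y : TangleWord)

/-- The elementary pieces of oriented classical tangle diagrams, with all possible orientations.
* `over a b`: the strand which starts on the left passes over the other one;
* `under a b`: the strand which starts on the left passes under the other one;
* `cap a b`, `cup a b`: a local extremum; its two ends carry opposite signs. -/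
inductive ClassicalPiece : TangleWord → TangleWord → Type
  | over (a b : OrientationSign) :
      ClassicalPiece (.tensor (.letter a) (.letter b)) (.tensor (.letter b) (.letter a))
  | under (a b : OrientationSign) :
      ClassicalPiece (.tensor (.letter a) (.letter b)) (.tensor (.letter b) (.letter a))
  | cap (a b : OrientationSign) (h : a ≠ b) :
      ClassicalPiece (.tensor (.letter a) (.letter b)) .unit
  | cup (a b : OrientationSign) (h : a ≠ b) :
      ClassicalPiece .unit (.tensor (.letter a) (.letter b))

/-- The elementary pieces of oriented virtual tangle diagrams: the classical ones together with
the virtual crossings. -/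
inductive VirtualPiece : TangleWord → TangleWord → Type
  | classical {X Y : TangleWord} (p : ClassicalPiece X Y) : VirtualPiece X Y
  | virtual (a b : OrientationSign) :
      VirtualPiece (.tensor (.letter a) (.letter b)) (.tensor (.letter b) (.letter a))

/-- Diagrams obtained from the elementary pieces in `P` by composition (stacking; `f.comp g` is
`f` followed by `g`) and tensor product (juxtaposition).  The pieces `assoc`, `leftUnit`,
`rightUnit` and their inverses are identity tangles which only change the parenthesisation. -/
inductive TangleDiagram (P : TangleWord → TangleWord → Type) : TangleWord → TangleWord → Type
  | piece {X Y : TangleWord} (p : P X Y) : TangleDiagram P X Y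
  | idTangle (X : TangleWord) : TangleDiagram P X X
  | comp {X Y Z : TangleWord} (f : TangleDiagram P X Y) (g : TangleDiagram P Y Z) :
      TangleDiagram P X Z
  | tensor {X Y X' Y' : TangleWord} (f : TangleDiagram P X Y) (g : TangleDiagram P X' Y') :
      TangleDiagram P (.tensor X X') (.tensor Y Y')
  | assoc (X Y Z : TangleWord) :
      TangleDiagram P (.tensor (.tensor X Y) Z) (.tensor X (.tensor Y Z))
  | assocInv (X Y Z : TangleWord) :
      TangleDiagram P (.tensor X (.tensor Y Z)) (.tensor (.tensor X Y) Z)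
  | leftUnit (X : TangleWord) : TangleDiagram P (.tensor .unit X) X
  | leftUnitInv (X : TangleWord) : TangleDiagram P X (.tensor .unit X)
  | rightUnit (X : TangleWord) : TangleDiagram P (.tensor X .unit) X
  | rightUnitInv (X : TangleWord) : TangleDiagram P X (.tensor X .unit)

namespace TangleDiagram

/-- The monoidal congruence generated by a family `M` of local moves: the smallest equivalence
relation on diagrams which contains `M`, is stable under composition and tensor product, and
contains the relations expressing that diagrams form a monoidal category. -/
inductive Equivalent {P : TangleWord → TangleWord → Type}
    (M : ∀ X Y : TangleWord, TangleDiagram P X Y → TangleDiagram P X Y → Prop) :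
    ∀ {X Y : TangleWord}, TangleDiagram P X Y → TangleDiagram P X Y → Prop
  | move {X Y : TangleWord} {f g : TangleDiagram P X Y} (h : M X Y f g) : Equivalent M f g
  | refl {X Y : TangleWord} (f : TangleDiagram P X Y) : Equivalent M f f
  | symm {X Y : TangleWord} {f g : TangleDiagram P X Y} (h : Equivalent M f g) :
      Equivalent M g f
  | trans {X Y : TangleWord} {f g h : TangleDiagram P X Y} (h₁ : Equivalent M f g)
      (h₂ : Equivalent M g h) : Equivalent M f h
  | comp_congr {X Y Z : TangleWord} {f f' : TangleDiagram P X Y} {g g' : TangleDiagram P Y Z}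
      (h₁ : Equivalent M f f') (h₂ : Equivalent M g g') :
      Equivalent M (f.comp g) (f'.comp g')
  | tensor_congr {X Y X' Y' : TangleWord} {f f' : TangleDiagram P X Y}
      {g g' : TangleDiagram P X' Y'} (h₁ : Equivalent M f f') (h₂ : Equivalent M g g') :
      Equivalent M (f.tensor g) (f'.tensor g')
  | id_comp {X Y : TangleWord} (f : TangleDiagram P X Y) : Equivalent M ((idTangle X).comp f) f
  | comp_id {X Y : TangleWord} (f : TangleDiagram P X Y) : Equivalent M (f.comp (idTangle Y)) f
  | comp_assoc {X Y Z W : TangleWord} (f : TangleDiagram P X Y) (g : TangleDiagram P Y Z)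
      (h : TangleDiagram P Z W) : Equivalent M ((f.comp g).comp h) (f.comp (g.comp h))
  | tensor_id (X Y : TangleWord) : Equivalent M ((idTangle X).tensor (idTangle Y)) (idTangle (.tensor X Y))
  | interchange {X Y Z X' Y' Z' : TangleWord} (f : TangleDiagram P X Y) (g : TangleDiagram P Y Z)
      (f' : TangleDiagram P X' Y') (g' : TangleDiagram P Y' Z') :
      Equivalent M ((f.tensor f').comp (g.tensor g')) ((f.comp g).tensor (f'.comp g'))
  | assoc_natural {X Y X' Y' X'' Y'' : TangleWord} (f : TangleDiagram P X Y)
      (f' : TangleDiagram P X' Y') (f'' : TangleDiagram P X'' Y'') :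
      Equivalent M (((f.tensor f').tensor f'').comp (assoc Y Y' Y''))
        ((assoc X X' X'').comp (f.tensor (f'.tensor f'')))
  | leftUnit_natural {X Y : TangleWord} (f : TangleDiagram P X Y) :
      Equivalent M (((idTangle .unit).tensor f).comp (leftUnit Y)) ((leftUnit X).comp f)
  | rightUnit_natural {X Y : TangleWord} (f : TangleDiagram P X Y) :
      Equivalent M ((f.tensor (idTangle .unit)).comp (rightUnit Y)) ((rightUnit X).comp f)
  | assoc_assocInv (X Y Z : TangleWord) :
      Equivalent M ((assoc X Y Z).comp (assocInv X Y Z)) (idTangle _)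
  | assocInv_assoc (X Y Z : TangleWord) :
      Equivalent M ((assocInv X Y Z).comp (assoc X Y Z)) (idTangle _)
  | leftUnit_leftUnitInv (X : TangleWord) :
      Equivalent M ((leftUnit X).comp (leftUnitInv X)) (idTangle _)
  | leftUnitInv_leftUnit (X : TangleWord) :
      Equivalent M ((leftUnitInv X).comp (leftUnit X)) (idTangle _)
  | rightUnit_rightUnitInv (X : TangleWord) :
      Equivalent M ((rightUnit X).comp (rightUnitInv X)) (idTangle _)
  | rightUnitInv_rightUnit (X : TangleWord) :
      Equivalent M ((rightUnitInv X).comp (rightUnit X)) (idTangle _)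
  | pentagon (W X Y Z : TangleWord) :
      Equivalent M
        (((assoc W X Y).tensor (idTangle Z)).comp
          ((assoc W (.tensor X Y) Z).comp ((idTangle W).tensor (assoc X Y Z))))
        ((assoc (.tensor W X) Y Z).comp (assoc W X (.tensor Y Z)))
  | triangle (X Y : TangleWord) :
      Equivalent M ((assoc X .unit Y).comp ((idTangle X).tensor (leftUnit Y)))
        ((rightUnit X).tensor (idTangle Y))

/-- A classical diagram, seen as a virtual diagram without virtual crossings. -/
def toVirtual {X Y : TangleWord} :
    TangleDiagram ClassicalPiece X Y → TangleDiagram VirtualPiece X Y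
  | piece p => piece (.classical p)
  | idTangle X => idTangle X
  | comp f g => f.toVirtual.comp g.toVirtual
  | tensor f g => f.toVirtual.tensor g.toVirtual
  | assoc X Y Z => assoc X Y Z
  | assocInv X Y Z => assocInv X Y Z
  | leftUnit X => leftUnit X
  | leftUnitInv X => leftUnitInv X
  | rightUnit X => rightUnit X
  | rightUnitInv X => rightUnitInv X

end TangleDiagram

section Moves

open TangleDiagram

/-- The identity diagram of a single strand. -/
abbrev strand {P : TangleWord → TangleWord → Type} (a : OrientationSign) :
    TangleDiagram P (.letter a) (.letter a) :=
  .idTangle (.letter a)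

abbrev overCrossing (a b : OrientationSign) : TangleDiagram ClassicalPiece
    (.tensor (.letter a) (.letter b)) (.tensor (.letter b) (.letter a)) :=
  .piece (.over a b)

abbrev underCrossing (a b : OrientationSign) : TangleDiagram ClassicalPiece
    (.tensor (.letter a) (.letter b)) (.tensor (.letter b) (.letter a)) :=
  .piece (.under a b)

abbrev capDiagram (a b : OrientationSign) (h : a ≠ b) : TangleDiagram ClassicalPiece
    (.tensor (.letter a) (.letter b)) .unit :=
  .piece (.cap a b h)

abbrev cupDiagram (a b : OrientationSign) (h : a ≠ b) : TangleDiagram ClassicalPiece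
    .unit (.tensor (.letter a) (.letter b)) :=
  .piece (.cup a b h)

abbrev virtualCrossing (a b : OrientationSign) : TangleDiagram VirtualPiece
    (.tensor (.letter a) (.letter b)) (.tensor (.letter b) (.letter a)) :=
  .piece (.virtual a b)

/-- `(x ⊗ c) ⊗ b ⟶ c`, joining the outer ends `x`, `b` by a cap after the strand `c` has crossed
the right leg `b` by means of `X`. -/
abbrev slideCapRight {P : TangleWord → TangleWord → Type} {a b c : TangleWord}
    (X : TangleDiagram P (.tensor c b) (.tensor b c)) (C : TangleDiagram P (.tensor a b) .unit) :
    TangleDiagram P (.tensor (.tensor a c) b) c :=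
  (assoc a c b).comp <| ((idTangle a).tensor X).comp <| (assocInv a b c).comp <|
    (C.tensor (idTangle c)).comp (leftUnit c)

/-- The same with the strand `c` crossing the left leg of the cap. -/
abbrev slideCapLeft {P : TangleWord → TangleWord → Type} {a b c : TangleWord}
    (X : TangleDiagram P (.tensor a c) (.tensor c a)) (C : TangleDiagram P (.tensor a b) .unit) :
    TangleDiagram P (.tensor (.tensor a c) b) c :=
  (X.tensor (idTangle b)).comp <| (assoc c a b).comp <| ((idTangle c).tensor C).comp (rightUnit c)

/-- `c ⟶ (a ⊗ c) ⊗ b`, where the strand `c` crosses the right leg of a cup. -/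
abbrev slideCupRight {P : TangleWord → TangleWord → Type} {a b c : TangleWord}
    (X : TangleDiagram P (.tensor b c) (.tensor c b)) (C : TangleDiagram P .unit (.tensor a b)) :
    TangleDiagram P c (.tensor (.tensor a c) b) :=
  (leftUnitInv c).comp <| (C.tensor (idTangle c)).comp <| (assoc a b c).comp <|
    ((idTangle a).tensor X).comp (assocInv a c b)

/-- `c ⟶ (a ⊗ c) ⊗ b`, where the strand `c` crosses the left leg of a cup. -/
abbrev slideCupLeft {P : TangleWord → TangleWord → Type} {a b c : TangleWord}
    (X : TangleDiagram P (.tensor c a) (.tensor a c)) (C : TangleDiagram P .unit (.tensor a b)) :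
    TangleDiagram P c (.tensor (.tensor a c) b) :=
  (rightUnitInv c).comp <| ((idTangle c).tensor C).comp <| (assocInv c a b).comp (X.tensor (idTangle b))

/-- The left-hand side of a third Reidemeister move, `(a ⊗ b) ⊗ c ⟶ (c ⊗ b) ⊗ a`:
the crossings are those of `a, b`, then of `a, c`, then of `b, c`. -/
abbrev tripleLeft {P : TangleWord → TangleWord → Type} {a b c : TangleWord}
    (X : TangleDiagram P (.tensor a b) (.tensor b a))
    (Y : TangleDiagram P (.tensor a c) (.tensor c a))
    (Z : TangleDiagram P (.tensor b c) (.tensor c b)) :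
    TangleDiagram P (.tensor (.tensor a b) c) (.tensor (.tensor c b) a) :=
  (X.tensor (idTangle c)).comp <| (assoc b a c).comp <| ((idTangle b).tensor Y).comp <|
    (assocInv b c a).comp (Z.tensor (idTangle a))

/-- The right-hand side of a third Reidemeister move, `(a ⊗ b) ⊗ c ⟶ (c ⊗ b) ⊗ a`:
the crossings are those of `b, c`, then of `a, c`, then of `a, b`. -/
abbrev tripleRight {P : TangleWord → TangleWord → Type} {a b c : TangleWord}
    (X : TangleDiagram P (.tensor a b) (.tensor b a))
    (Y : TangleDiagram P (.tensor a c) (.tensor c a))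
    (Z : TangleDiagram P (.tensor b c) (.tensor c b)) :
    TangleDiagram P (.tensor (.tensor a b) c) (.tensor (.tensor c b) a) :=
  (assoc a b c).comp <| ((idTangle a).tensor Z).comp <| (assocInv a c b).comp <|
    (Y.tensor (idTangle b)).comp <| (assoc c a b).comp <| ((idTangle c).tensor X).comp (assocInv c b a)

/-- Generating moves between classical tangle diagrams presenting framed (blackboard framing)
oriented tangles: planar isotopies (`zigzag`, `cap_slide`, `cup_slide`; the exchange of distant
pieces is part of `TangleDiagram.Equivalent`) and the Reidemeister moves for framed tangles.
The framed first move `reidemeister₁` identifies the two curls with the same crossing on the two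
sides of a strand. -/
inductive FramedMove : ∀ X Y : TangleWord,
    TangleDiagram ClassicalPiece X Y → TangleDiagram ClassicalPiece X Y → Prop
  | zigzag_left (a b : OrientationSign) (h : a ≠ b) :
      FramedMove _ _
        ((rightUnitInv (.letter a)).comp <| ((strand a).tensor (cupDiagram b a h.symm)).comp <|
          (assocInv (.letter a) (.letter b) (.letter a)).comp <|
          ((capDiagram a b h).tensor (strand a)).comp (leftUnit (.letter a)))
        (strand a)
  | zigzag_right (a b : OrientationSign) (h : a ≠ b) :
      FramedMove _ _
        ((leftUnitInv (.letter a)).comp <| ((cupDiagram a b h).tensor (strand a)).comp <|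
          (assoc (.letter a) (.letter b) (.letter a)).comp <|
          ((strand a).tensor (capDiagram b a h.symm)).comp (rightUnit (.letter a)))
        (strand a)
  | cap_slide_over (a b c : OrientationSign) (h : a ≠ b) :
      FramedMove _ _ (slideCapRight (overCrossing c b) (capDiagram a b h))
        (slideCapLeft (underCrossing a c) (capDiagram a b h))
  | cap_slide_under (a b c : OrientationSign) (h : a ≠ b) :
      FramedMove _ _ (slideCapRight (underCrossing c b) (capDiagram a b h))
        (slideCapLeft (overCrossing a c) (capDiagram a b h))
  | cup_slide_over (a b c : OrientationSign) (h : a ≠ b) :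
      FramedMove _ _ (slideCupRight (underCrossing b c) (cupDiagram a b h))
        (slideCupLeft (overCrossing c a) (cupDiagram a b h))
  | cup_slide_under (a b c : OrientationSign) (h : a ≠ b) :
      FramedMove _ _ (slideCupRight (overCrossing b c) (cupDiagram a b h))
        (slideCupLeft (underCrossing c a) (cupDiagram a b h))
  | reidemeister₁ (a b : OrientationSign) (h : a ≠ b) :
      FramedMove _ _
        ((rightUnitInv (.letter a)).comp <| ((strand a).tensor (cupDiagram a b h)).comp <|
          (assocInv (.letter a) (.letter a) (.letter b)).comp <|
          ((overCrossing a a).tensor (strand b)).comp <|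
          (assoc (.letter a) (.letter a) (.letter b)).comp <|
          ((strand a).tensor (capDiagram a b h)).comp (rightUnit (.letter a)))
        ((leftUnitInv (.letter a)).comp <| ((cupDiagram b a h.symm).tensor (strand a)).comp <|
          (assoc (.letter b) (.letter a) (.letter a)).comp <|
          ((strand b).tensor (overCrossing a a)).comp <|
          (assocInv (.letter b) (.letter a) (.letter a)).comp <|
          ((capDiagram b a h.symm).tensor (strand a)).comp (leftUnit (.letter a)))
  | reidemeister₂_over_under (a b : OrientationSign) :
      FramedMove _ _ ((overCrossing a b).comp (underCrossing b a)) (.idTangle _)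
  | reidemeister₂_under_over (a b : OrientationSign) :
      FramedMove _ _ ((underCrossing a b).comp (overCrossing b a)) (.idTangle _)
  | reidemeister₃ (a b c : OrientationSign) :
      FramedMove _ _ (tripleLeft (overCrossing a b) (overCrossing a c) (overCrossing b c))
        (tripleRight (overCrossing a b) (overCrossing a c) (overCrossing b c))

/-- Generating moves between virtual tangle diagrams: the moves between classical diagrams, the
planar isotopies moving a virtual crossing past an extremum, the second and third virtual
Reidemeister moves, and the mixed move.  There is no virtual first Reidemeister move. -/
inductive VirtualMove : ∀ X Y : TangleWord,
    TangleDiagram VirtualPiece X Y → TangleDiagram VirtualPiece X Y → Prop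
  | classical {X Y : TangleWord} {f g : TangleDiagram ClassicalPiece X Y} (h : FramedMove X Y f g) :
      VirtualMove _ _ f.toVirtual g.toVirtual
  | cap_slide (a b c : OrientationSign) (h : a ≠ b) :
      VirtualMove _ _ (slideCapRight (virtualCrossing c b) (capDiagram a b h).toVirtual)
        (slideCapLeft (virtualCrossing a c) (capDiagram a b h).toVirtual)
  | cup_slide (a b c : OrientationSign) (h : a ≠ b) :
      VirtualMove _ _ (slideCupRight (virtualCrossing b c) (cupDiagram a b h).toVirtual)
        (slideCupLeft (virtualCrossing c a) (cupDiagram a b h).toVirtual)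
  | virtual₂ (a b : OrientationSign) :
      VirtualMove _ _ ((virtualCrossing a b).comp (virtualCrossing b a)) (.idTangle _)
  | virtual₃ (a b c : OrientationSign) :
      VirtualMove _ _ (tripleLeft (virtualCrossing a b) (virtualCrossing a c) (virtualCrossing b c))
        (tripleRight (virtualCrossing a b) (virtualCrossing a c) (virtualCrossing b c))
  | mixed (a b c : OrientationSign) :
      VirtualMove _ _
        (tripleLeft (virtualCrossing a b) (overCrossing a c).toVirtual (virtualCrossing b c))
        (tripleRight (virtualCrossing a b) (overCrossing a c).toVirtual (virtualCrossing b c))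

theorem TangleDiagram.Equivalent.toVirtual {X Y : TangleWord}
    {f g : TangleDiagram ClassicalPiece X Y} (h : Equivalent FramedMove f g) :
    Equivalent VirtualMove f.toVirtual g.toVirtual := by
  induction h with
  | move h => exact .move (.classical h)
  | refl f => exact .refl _
  | symm _ ih => exact .symm ih
  | trans _ _ ih₁ ih₂ => exact .trans ih₁ ih₂
  | comp_congr _ _ ih₁ ih₂ => exact .comp_congr ih₁ ih₂
  | tensor_congr _ _ ih₁ ih₂ => exact .tensor_congr ih₁ ih₂
  | id_comp f => exact .id_comp _
  | comp_id f => exact .comp_id _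
  | comp_assoc f g h => exact .comp_assoc _ _ _
  | tensor_id X Y => exact .tensor_id _ _
  | interchange f g f' g' => exact .interchange _ _ _ _
  | assoc_natural f f' f'' => exact .assoc_natural _ _ _
  | leftUnit_natural f => exact .leftUnit_natural _
  | rightUnit_natural f => exact .rightUnit_natural _
  | assoc_assocInv X Y Z => exact .assoc_assocInv _ _ _
  | assocInv_assoc X Y Z => exact .assocInv_assoc _ _ _
  | leftUnit_leftUnitInv X => exact .leftUnit_leftUnitInv _
  | leftUnitInv_leftUnit X => exact .leftUnitInv_leftUnit _
  | rightUnit_rightUnitInv X => exact .rightUnit_rightUnitInv _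
  | rightUnitInv_rightUnit X => exact .rightUnitInv_rightUnit _
  | pentagon W X Y Z => exact .pentagon _ _ _ _
  | triangle X Y => exact .triangle _ _

end Moves

/-- Diagrams of classical links: classical tangle diagrams without ends. -/
abbrev LinkDiagram : Type := TangleDiagram ClassicalPiece .unit .unit

/-- Diagrams of virtual links: virtual tangle diagrams without ends. -/
abbrev VirtualLinkDiagram : Type := TangleDiagram VirtualPiece .unit .unit

/-- Framed oriented (classical) links. -/
def FramedLink : Type := Quot fun D D' : LinkDiagram => TangleDiagram.Equivalent FramedMove D D'

/-- Framed oriented virtual links. -/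
def FramedVirtualLink : Type :=
  Quot fun D D' : VirtualLinkDiagram => TangleDiagram.Equivalent VirtualMove D D'

/-- The framed link presented by a diagram. -/
def FramedLink.mk (D : LinkDiagram) : FramedLink := Quot.mk _ D

/-- The framed virtual link presented by a diagram. -/
def FramedVirtualLink.mk (D : VirtualLinkDiagram) : FramedVirtualLink := Quot.mk _ D

/-- A classical link, seen as a virtual link. -/
def FramedLink.toVirtual : FramedLink → FramedVirtualLink :=
  Quot.map TangleDiagram.toVirtual fun _ _ h => h.toVirtual

/-! ## Evaluation of diagrams in a monoidal category -/

section Evaluation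

variable {C : Type*} [Category C] [MonoidalCategory C]

/-- The object attached to a word, given the objects attached to the letters. -/
def TangleWord.obj (c : OrientationSign → C) : TangleWord → C
  | unit => 𝟙_ C
  | letter a => c a
  | tensor X Y => X.obj c ⊗ Y.obj c

/-- The morphism attached to a diagram, given the morphisms attached to the elementary pieces. -/
def TangleDiagram.eval {P : TangleWord → TangleWord → Type} (c : OrientationSign → C)
    (φ : ∀ {X Y : TangleWord}, P X Y → (X.obj c ⟶ Y.obj c)) {X Y : TangleWord} :
    TangleDiagram P X Y → (X.obj c ⟶ Y.obj c)
  | piece p => φ p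
  | idTangle X => 𝟙 (X.obj c)
  | comp f g => f.eval c φ ≫ g.eval c φ
  | tensor f g => f.eval c φ ⊗ₘ g.eval c φ
  | assoc X Y Z => (α_ (X.obj c) (Y.obj c) (Z.obj c)).hom
  | assocInv X Y Z => (α_ (X.obj c) (Y.obj c) (Z.obj c)).inv
  | leftUnit X => (λ_ (X.obj c)).hom
  | leftUnitInv X => (λ_ (X.obj c)).inv
  | rightUnit X => (ρ_ (X.obj c)).hom
  | rightUnitInv X => (ρ_ (X.obj c)).inv

end Evaluation

/-! ## Ribbon Hopf algebras and their finite-dimensional modules -/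

section Hopf

variable (k : Type u) (H : Type w) [Field k] [Ring H] [HopfAlgebra k H]

/-- A ribbon structure on a Hopf algebra: a universal `R`-matrix (quasi-triangular structure)
together with a ribbon element `v`. -/
structure RibbonStructure where
  /-- The universal `R`-matrix. -/
  R : (H ⊗[k] H)ˣ
  /-- `R Δ(h) = Δᵒᵖ(h) R`. -/
  R_mul_comul : ∀ h : H,
    (R : H ⊗[k] H) * Coalgebra.comul (R := k) h =
      TensorProduct.comm k H H (Coalgebra.comul (R := k) h) * (R : H ⊗[k] H)
  /-- `(Δ ⊗ id)(R) = R₁₃ R₂₃`. -/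
  comul_left : (Coalgebra.comul (R := k) (A := H)).rTensor H (R : H ⊗[k] H) =
    Algebra.TensorProduct.map
        (Algebra.TensorProduct.includeLeft : H →ₐ[k] H ⊗[k] H) (AlgHom.id k H) (R : H ⊗[k] H) *
      Algebra.TensorProduct.map
        (Algebra.TensorProduct.includeRight : H →ₐ[k] H ⊗[k] H) (AlgHom.id k H) (R : H ⊗[k] H)
  /-- `(id ⊗ Δ)(R) = R₁₃ R₁₂`. -/
  comul_right : (Coalgebra.comul (R := k) (A := H)).lTensor H (R : H ⊗[k] H) =
    Algebra.TensorProduct.map (AlgHom.id k H)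
        (Algebra.TensorProduct.includeRight : H →ₐ[k] H ⊗[k] H) (R : H ⊗[k] H) *
      Algebra.TensorProduct.map (AlgHom.id k H)
        (Algebra.TensorProduct.includeLeft : H →ₐ[k] H ⊗[k] H) (R : H ⊗[k] H)
  /-- The ribbon element. -/
  v : Hˣ
  v_central : ∀ h : H, (v : H) * h = h * (v : H)
  /-- `v² = u S(u)`, where `u = ∑ S(bᵢ) aᵢ` is the Drinfeld element of `R = ∑ aᵢ ⊗ bᵢ`. -/
  v_sq : (v : H) ^ 2 =
    LinearMap.mul' k H
        ((HopfAlgebra.antipode k (A := H)).rTensor H (TensorProduct.comm k H H (R : H ⊗[k] H))) *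
      HopfAlgebra.antipode k (LinearMap.mul' k H
        ((HopfAlgebra.antipode k (A := H)).rTensor H (TensorProduct.comm k H H (R : H ⊗[k] H))))
  antipode_v : HopfAlgebra.antipode k (v : H) = (v : H)
  counit_v : Coalgebra.counit (R := k) (v : H) = 1
  /-- `R₂₁ R Δ(v) = v ⊗ v`. -/
  comul_v : TensorProduct.comm k H H (R : H ⊗[k] H) * (R : H ⊗[k] H) *
    Coalgebra.comul (R := k) (v : H) = (v : H) ⊗ₜ[k] (v : H)

end Hopf

/-! Actions of `H` are algebra homomorphisms `H →ₐ[k] Module.End k V`. -/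

section Actions

variable {k : Type u} {H : Type w} [Field k] [Ring H] [HopfAlgebra k H]
variable {V W U V' W' : Type u} [AddCommGroup V] [Module k V] [AddCommGroup W] [Module k W]
  [AddCommGroup U] [Module k U] [AddCommGroup V'] [Module k V'] [AddCommGroup W'] [Module k W']

/-- The action of `H ⊗ H` on `V ⊗ W`, given actions of `H` on `V` and `W`. -/
def act₂ (ρ : H →ₐ[k] Module.End k V) (σ : H →ₐ[k] Module.End k W) :
    H ⊗[k] H →ₐ[k] Module.End k (V ⊗[k] W) :=
  Module.endTensorEndAlgHom.comp (Algebra.TensorProduct.map ρ σ)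

/-- The action of `H` on `V ⊗ W` through the comultiplication. -/
def tensorAct (ρ : H →ₐ[k] Module.End k V) (σ : H →ₐ[k] Module.End k W) :
    H →ₐ[k] Module.End k (V ⊗[k] W) :=
  (act₂ ρ σ).comp (Bialgebra.comulAlgHom k H)

variable (k H) in
/-- The action of `H` on `k` through the counit. -/
def trivialAct : H →ₐ[k] Module.End k k :=
  (Algebra.ofId k (Module.End k k)).comp (Bialgebra.counitAlgHom k H)

/-- The action of `H` on the dual space, `(h f)(x) = f(S(h) x)`. -/
def dualAct (ρ : H →ₐ[k] Module.End k V) : H →ₐ[k] Module.End k (Module.Dual k V) :=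
  AlgHom.ofLinearMap
    (Module.Dual.transpose ∘ₗ ρ.toLinearMap ∘ₗ HopfAlgebra.antipode k (A := H))
    (by simp only [LinearMap.comp_apply, HopfAlgebra.antipode_one, AlgHom.toLinearMap_apply,
          map_one]; rfl)
    (fun a b => by
      simp only [LinearMap.comp_apply, HopfAlgebra.antipode_mul_antidistrib,
        AlgHom.toLinearMap_apply, map_mul]; rfl)

theorem dualAct_apply (ρ : H →ₐ[k] Module.End k V) (h : H) (f : Module.Dual k V) (x : V) :
    dualAct ρ h f x = f (ρ (HopfAlgebra.antipode k h) x) := rfl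

theorem act₂_tmul (ρ : H →ₐ[k] Module.End k V) (σ : H →ₐ[k] Module.End k W) (a b : H) :
    act₂ ρ σ (a ⊗ₜ b) = TensorProduct.map (ρ a) (σ b) := rfl

theorem tensorAct_apply (ρ : H →ₐ[k] Module.End k V) (σ : H →ₐ[k] Module.End k W) (h : H) :
    tensorAct ρ σ h = act₂ ρ σ (Coalgebra.comul h) := rfl

theorem trivialAct_apply (h : H) (c : k) :
    trivialAct k H h c = Coalgebra.counit (R := k) h * c := rfl

theorem act₂_natural {ρ : H →ₐ[k] Module.End k V} {σ : H →ₐ[k] Module.End k W}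
    {ρ' : H →ₐ[k] Module.End k V'} {σ' : H →ₐ[k] Module.End k W'} {f : V →ₗ[k] V'}
    {g : W →ₗ[k] W'} (hf : ∀ h, f ∘ₗ ρ h = ρ' h ∘ₗ f) (hg : ∀ h, g ∘ₗ σ h = σ' h ∘ₗ g)
    (t : H ⊗[k] H) :
    TensorProduct.map f g ∘ₗ act₂ ρ σ t = act₂ ρ' σ' t ∘ₗ TensorProduct.map f g := by
  induction t with
  | zero => simp
  | add x y hx hy => rw [map_add, map_add, LinearMap.comp_add, LinearMap.add_comp, hx, hy]
  | tmul a b =>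
    rw [act₂_tmul, act₂_tmul, ← TensorProduct.map_comp, ← TensorProduct.map_comp, hf, hg]

theorem act₂_comm (ρ : H →ₐ[k] Module.End k V) (σ : H →ₐ[k] Module.End k W) (t : H ⊗[k] H)
    (x : V ⊗[k] W) :
    TensorProduct.comm k V W (act₂ ρ σ t x) =
      act₂ σ ρ (TensorProduct.comm k H H t) (TensorProduct.comm k V W x) := by
  induction t with
  | zero => simp
  | add a b ha hb => simp only [map_add, LinearMap.add_apply, ha, hb]
  | tmul a b =>
    induction x with
    | zero => simp
    | add x y hx hy => simp only [map_add, hx, hy]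
    | tmul x y => rfl

theorem tensorAct_assoc (ρ : H →ₐ[k] Module.End k V) (σ : H →ₐ[k] Module.End k W)
    (τ : H →ₐ[k] Module.End k U) (h : H) :
    (TensorProduct.assoc k V W U).toLinearMap ∘ₗ tensorAct (tensorAct ρ σ) τ h =
      tensorAct ρ (tensorAct σ τ) h ∘ₗ (TensorProduct.assoc k V W U).toLinearMap := by
  have key₁ : ∀ t : H ⊗[k] H, act₂ (tensorAct ρ σ) τ t =
      Module.endTensorEndAlgHom (R := k) (S := k) (A := k)
        (Algebra.TensorProduct.map (act₂ ρ σ) τ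
          ((Coalgebra.comul (R := k) (A := H)).rTensor H t)) := by
    intro t
    induction t with
    | zero => simp
    | add a b ha hb => simp only [map_add, ha, hb]
    | tmul a b => rfl
  have key₂ : ∀ t : H ⊗[k] H, act₂ ρ (tensorAct σ τ) t =
      Module.endTensorEndAlgHom (R := k) (S := k) (A := k)
        (Algebra.TensorProduct.map ρ (act₂ σ τ)
          ((Coalgebra.comul (R := k) (A := H)).lTensor H t)) := by
    intro t
    induction t with
    | zero => simp
    | add a b ha hb => simp only [map_add, ha, hb]
    | tmul a b => rfl
  have key₃ : ∀ t : (H ⊗[k] H) ⊗[k] H, ∀ x : V, ∀ y : W, ∀ z : U,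
      TensorProduct.assoc k V W U
        (Module.endTensorEndAlgHom (R := k) (S := k) (A := k)
          (Algebra.TensorProduct.map (act₂ ρ σ) τ t) ((x ⊗ₜ y) ⊗ₜ z)) =
      Module.endTensorEndAlgHom (R := k) (S := k) (A := k)
          (Algebra.TensorProduct.map ρ (act₂ σ τ) (TensorProduct.assoc k H H H t))
          (x ⊗ₜ (y ⊗ₜ z)) := by
    intro t x y z
    induction t with
    | zero => simp
    | add a b ha hb => simp only [map_add, LinearMap.add_apply, ha, hb]
    | tmul s c =>
      induction s with
      | zero => simp
      | add a b ha hb => simp only [TensorProduct.add_tmul, map_add, LinearMap.add_apply, ha, hb]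
      | tmul a b => rfl
  refine TensorProduct.ext_threefold fun x y z => ?_
  simp only [LinearMap.comp_apply, LinearEquiv.coe_coe, TensorProduct.assoc_tmul,
    tensorAct_apply (tensorAct ρ σ), tensorAct_apply ρ (tensorAct σ τ)]
  rw [key₁, key₂, key₃, Coalgebra.coassoc_apply]

theorem tensorAct_lid (ρ : H →ₐ[k] Module.End k V) (h : H) :
    (TensorProduct.lid k V).toLinearMap ∘ₗ tensorAct (trivialAct k H) ρ h =
      ρ h ∘ₗ (TensorProduct.lid k V).toLinearMap := by
  have key : ∀ t : H ⊗[k] H, ∀ c : k, ∀ x : V,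
      TensorProduct.lid k V (act₂ (trivialAct k H) ρ t (c ⊗ₜ x)) =
        c • ρ (TensorProduct.lid k H ((Coalgebra.counit (R := k) (A := H)).rTensor H t)) x := by
    intro t c x
    induction t with
    | zero => simp
    | add a b ha hb => simp only [map_add, LinearMap.add_apply, ha, hb, smul_add]
    | tmul a b =>
      rw [act₂_tmul, TensorProduct.map_tmul, TensorProduct.lid_tmul, LinearMap.rTensor_tmul,
        TensorProduct.lid_tmul, map_smul, LinearMap.smul_apply, smul_smul, mul_comm c,
        trivialAct_apply]
  refine TensorProduct.ext' fun c x => ?_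
  refine (key (Coalgebra.comul h) c x).trans ?_
  rw [Coalgebra.rTensor_counit_comul, TensorProduct.lid_tmul, one_smul]
  exact (map_smul (ρ h) c x).symm

theorem tensorAct_rid (ρ : H →ₐ[k] Module.End k V) (h : H) :
    (TensorProduct.rid k V).toLinearMap ∘ₗ tensorAct ρ (trivialAct k H) h =
      ρ h ∘ₗ (TensorProduct.rid k V).toLinearMap := by
  have key : ∀ t : H ⊗[k] H, ∀ c : k, ∀ x : V,
      TensorProduct.rid k V (act₂ ρ (trivialAct k H) t (x ⊗ₜ c)) =
        c • ρ (TensorProduct.rid k H ((Coalgebra.counit (R := k) (A := H)).lTensor H t)) x := by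
    intro t c x
    induction t with
    | zero => simp
    | add a b ha hb => simp only [map_add, LinearMap.add_apply, ha, hb, smul_add]
    | tmul a b =>
      rw [act₂_tmul, TensorProduct.map_tmul, TensorProduct.rid_tmul, LinearMap.lTensor_tmul,
        TensorProduct.rid_tmul, map_smul, LinearMap.smul_apply, smul_smul, mul_comm c,
        trivialAct_apply]
  refine TensorProduct.ext' fun x c => ?_
  refine (key (Coalgebra.comul h) c x).trans ?_
  rw [Coalgebra.lTensor_counit_comul, TensorProduct.rid_tmul, one_smul]
  exact (map_smul (ρ h) c x).symm

/-- The braiding `x ⊗ y ↦ τ (R (x ⊗ y))`, with `τ` the flip. -/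
def braidMap (Q : RibbonStructure k H) (ρ : H →ₐ[k] Module.End k V)
    (σ : H →ₐ[k] Module.End k W) : V ⊗[k] W →ₗ[k] W ⊗[k] V :=
  (TensorProduct.comm k V W).toLinearMap ∘ₗ act₂ ρ σ (Q.R : H ⊗[k] H)

/-- The map `V ⊗ W ⟶ W ⊗ V`, `z ↦ R⁻¹ (τ z)`, inverse to the braiding `W ⊗ V ⟶ V ⊗ W`. -/
def braidInvMap (Q : RibbonStructure k H) (ρ : H →ₐ[k] Module.End k V)
    (σ : H →ₐ[k] Module.End k W) : V ⊗[k] W →ₗ[k] W ⊗[k] V :=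
  act₂ σ ρ (↑(Q.R⁻¹) : H ⊗[k] H) ∘ₗ (TensorProduct.comm k V W).toLinearMap

theorem braidMap_comm (Q : RibbonStructure k H) (ρ : H →ₐ[k] Module.End k V)
    (σ : H →ₐ[k] Module.End k W) (h : H) :
    braidMap Q ρ σ ∘ₗ tensorAct ρ σ h = tensorAct σ ρ h ∘ₗ braidMap Q ρ σ := by
  refine LinearMap.ext fun x => ?_
  have key : act₂ ρ σ (Q.R : H ⊗[k] H) (act₂ ρ σ (Coalgebra.comul h) x) =
      act₂ ρ σ (TensorProduct.comm k H H (Coalgebra.comul (R := k) h))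
        (act₂ ρ σ (Q.R : H ⊗[k] H) x) := by
    rw [← Module.End.mul_apply, ← Module.End.mul_apply, ← map_mul, ← map_mul, Q.R_mul_comul]
  simp only [braidMap, LinearMap.comp_apply, LinearEquiv.coe_coe, tensorAct_apply]
  have hcc : ∀ t : H ⊗[k] H, TensorProduct.comm k H H (TensorProduct.comm k H H t) = t :=
    fun t => (TensorProduct.comm k H H).symm_apply_apply t
  rw [key, act₂_comm, hcc]

theorem braidInvMap_braidMap (Q : RibbonStructure k H) (ρ : H →ₐ[k] Module.End k V)
    (σ : H →ₐ[k] Module.End k W) (x : V ⊗[k] W) :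
    braidInvMap Q σ ρ (braidMap Q ρ σ x) = x := by
  simp only [braidMap, braidInvMap, LinearMap.comp_apply, LinearEquiv.coe_coe]
  rw [← TensorProduct.comm_symm, LinearEquiv.symm_apply_apply, ← Module.End.mul_apply, ← map_mul,
    Units.inv_mul, map_one, Module.End.one_apply]

theorem braidMap_braidInvMap (Q : RibbonStructure k H) (ρ : H →ₐ[k] Module.End k V)
    (σ : H →ₐ[k] Module.End k W) (x : W ⊗[k] V) :
    braidMap Q ρ σ (braidInvMap Q σ ρ x) = x := by
  simp only [braidMap, braidInvMap, LinearMap.comp_apply, LinearEquiv.coe_coe]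
  rw [← Module.End.mul_apply, ← map_mul, Units.mul_inv, map_one, Module.End.one_apply,
    ← TensorProduct.comm_symm, LinearEquiv.symm_apply_apply]

theorem contractLeft_act (ρ : H →ₐ[k] Module.End k V) (h : H) :
    contractLeft k V ∘ₗ tensorAct (dualAct ρ) ρ h = trivialAct k H h ∘ₗ contractLeft k V := by
  have key : ∀ t : H ⊗[k] H, ∀ f : Module.Dual k V, ∀ x : V,
      contractLeft k V (act₂ (dualAct ρ) ρ t (f ⊗ₜ x)) =
        f (ρ (LinearMap.mul' k H ((HopfAlgebra.antipode k (A := H)).rTensor H t)) x) := by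
    intro t f x
    induction t with
    | zero => simp
    | add a b ha hb => simp only [map_add, LinearMap.add_apply, ha, hb]
    | tmul a b =>
      rw [act₂_tmul, TensorProduct.map_tmul, contractLeft_apply, LinearMap.rTensor_tmul,
        LinearMap.mul'_apply, map_mul, dualAct_apply, Module.End.mul_apply]
  refine TensorProduct.ext' fun f x => ?_
  refine (key (Coalgebra.comul h) f x).trans ?_
  rw [HopfAlgebra.mul_antipode_rTensor_comul_apply, AlgHom.commutes, Module.algebraMap_end_apply,
    map_smul]
  rfl

theorem coevaluation_transpose [FiniteDimensional k V] (A B : Module.End k V) :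
    TensorProduct.map A (Module.Dual.transpose (R := k) B) (coevaluation k V 1) =
      TensorProduct.map (A * B) LinearMap.id (coevaluation k V 1) := by
  let Φ : V ⊗[k] Module.Dual k V →ₗ[k] V →ₗ[k] V :=
    dualTensorHom k V V ∘ₗ (TensorProduct.comm k V (Module.Dual k V)).toLinearMap
  have hΦ : Function.Injective Φ :=
    (dualTensorHomEquiv k V V).injective.comp (TensorProduct.comm k V _).injective
  have hmap : ∀ (A B : Module.End k V) (z : V ⊗[k] Module.Dual k V),
      Φ (TensorProduct.map A (Module.Dual.transpose (R := k) B) z) = A ∘ₗ Φ z ∘ₗ B := by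
    intro A B z
    induction z with
    | zero => simp
    | add x y hx hy => simp only [map_add, hx, hy, LinearMap.add_comp, LinearMap.comp_add]
    | tmul x f => ext y; simp [Φ, dualTensorHom_apply, Module.Dual.transpose_apply]
  have hid : Φ (coevaluation k V 1) = LinearMap.id := by
    ext x
    rw [coevaluation_apply_one]
    simp only [Φ, map_sum, LinearMap.comp_apply, LinearEquiv.coe_coe, TensorProduct.comm_tmul,
      LinearMap.sum_apply, dualTensorHom_apply, LinearMap.id_apply]
    exact (Module.Basis.ofVectorSpace k V).sum_repr x
  apply hΦ
  have h₁ := hmap A B (coevaluation k V 1)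
  have h₂ := hmap (A * B) 1 (coevaluation k V 1)
  rw [hid] at h₁ h₂
  exact h₁.trans h₂.symm

theorem coevaluation_act [FiniteDimensional k V] (ρ : H →ₐ[k] Module.End k V) (h : H) :
    coevaluation k V ∘ₗ trivialAct k H h = tensorAct ρ (dualAct ρ) h ∘ₗ coevaluation k V := by
  have key : ∀ t : H ⊗[k] H, act₂ ρ (dualAct ρ) t (coevaluation k V 1) =
      TensorProduct.map (ρ (LinearMap.mul' k H ((HopfAlgebra.antipode k (A := H)).lTensor H t)))
        LinearMap.id (coevaluation k V 1) := by
    intro t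
    induction t with
    | zero => simp
    | add a b ha hb =>
      simp only [map_add, LinearMap.add_apply, ha, hb, TensorProduct.map_add_left]
    | tmul a b =>
      rw [act₂_tmul, LinearMap.lTensor_tmul, LinearMap.mul'_apply, map_mul]
      exact coevaluation_transpose _ _
  refine LinearMap.ext_ring ?_
  rw [LinearMap.comp_apply, LinearMap.comp_apply, tensorAct_apply, key,
    HopfAlgebra.mul_antipode_lTensor_comul_apply, AlgHom.commutes, trivialAct_apply, mul_one,
    ← mul_one (Coalgebra.counit (R := k) h), ← smul_eq_mul, map_smul, smul_eq_mul, mul_one,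
    Algebra.algebraMap_eq_smul_one, TensorProduct.map_smul_left]
  exact congrArg (Coalgebra.counit (R := k) h • ·)
    (LinearMap.congr_fun TensorProduct.map_id _).symm

end Actions

/-! ## The category of finite-dimensional modules -/

noncomputable section Modules

set_option linter.unusedVariables false

variable (k : Type u) (H : Type w) [Field k] [Ring H] [HopfAlgebra k H]

/-- Finite-dimensional left `H`-modules: a finite-dimensional vector space with an action of the
`k`-algebra `H`. -/
structure FDHMod where
  space : ModuleCat.{u} k
  finite : Module.Finite k space
  act : H →ₐ[k] Module.End k space

namespace FDHMod

variable {k H}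

attribute [instance] FDHMod.finite

/-- `H`-linear maps. -/
@[ext]
structure Hom (X Y : FDHMod.{u, w} k H) where
  map : X.space ⟶ Y.space
  comm : ∀ h : H, map.hom ∘ₗ X.act h = Y.act h ∘ₗ map.hom

instance : Category (FDHMod.{u, w} k H) where
  Hom X Y := Hom X Y
  id X := ⟨𝟙 _, fun h => rfl⟩
  comp f g := ⟨f.map ≫ g.map, fun h => by
    rw [ModuleCat.hom_comp, LinearMap.comp_assoc, f.comm, ← LinearMap.comp_assoc, g.comm,
      LinearMap.comp_assoc]⟩

/-- The functor sending an `H`-module to its underlying vector space. -/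
def forget : FDHMod.{u, w} k H ⥤ ModuleCat.{u} k where
  obj X := X.space
  map f := f.map

instance : (forget (k := k) (H := H)).Faithful where
  map_injective h := Hom.ext h

/-- The finite-dimensional module given by a vector space with an action of `H`. -/
def of {V : Type u} [AddCommGroup V] [Module k V] [FiniteDimensional k V]
    (ρ : H →ₐ[k] Module.End k V) : FDHMod.{u, w} k H where
  space := ModuleCat.of k V
  finite := inferInstanceAs (Module.Finite k V)
  act := ρ

variable (k H) in
/-- A finite-dimensional `H`-module, as an object of the category. -/
def ofModule (V : Type u) [AddCommGroup V] [Module k V] [Module H V] [IsScalarTower k H V]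
    [FiniteDimensional k V] : FDHMod.{u, w} k H :=
  of (Algebra.lsmul k k V : H →ₐ[k] Module.End k V)

/-- A morphism of `H`-modules from a linear map commuting with the action. -/
def ofLinear {X Y : FDHMod.{u, w} k H} (f : X.space →ₗ[k] Y.space)
    (hf : ∀ h : H, f ∘ₗ X.act h = Y.act h ∘ₗ f) : X ⟶ Y :=
  Hom.mk (ModuleCat.ofHom f) hf

/-- An isomorphism of `H`-modules from a linear equivalence commuting with the action. -/
def isoOfLinearEquiv {X Y : FDHMod.{u, w} k H} (e : X.space ≃ₗ[k] Y.space)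
    (he : ∀ h : H, e.toLinearMap ∘ₗ X.act h = Y.act h ∘ₗ e.toLinearMap) : X ≅ Y where
  hom := ofLinear e.toLinearMap he
  inv := ofLinear e.symm.toLinearMap fun h => LinearMap.ext fun y => by
    apply e.injective
    have := LinearMap.congr_fun (he h) (e.symm y)
    simp only [LinearMap.comp_apply, LinearEquiv.coe_coe, LinearEquiv.apply_symm_apply] at this ⊢
    exact this.symm
  hom_inv_id := Hom.ext (ModuleCat.hom_ext (LinearMap.ext fun x => e.symm_apply_apply x))
  inv_hom_id := Hom.ext (ModuleCat.hom_ext (LinearMap.ext fun x => e.apply_symm_apply x))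

/-- The tensor product of modules, with the associativity and unit constraints of vector
spaces. -/
instance : MonoidalCategoryStruct (FDHMod.{u, w} k H) where
  tensorObj X Y := of (tensorAct X.act Y.act)
  tensorUnit := of (trivialAct k H)
  tensorHom f g := ofLinear (TensorProduct.map f.map.hom g.map.hom)
    fun h => act₂_natural f.comm g.comm (Coalgebra.comul h)
  whiskerLeft X _ _ g := ofLinear (TensorProduct.map LinearMap.id g.map.hom)
    fun h => act₂_natural (fun _ => rfl) g.comm (Coalgebra.comul h)
  whiskerRight f Y := ofLinear (TensorProduct.map f.map.hom LinearMap.id)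
    fun h => act₂_natural f.comm (fun _ => rfl) (Coalgebra.comul h)
  associator X Y Z := isoOfLinearEquiv (TensorProduct.assoc k X.space Y.space Z.space)
    (tensorAct_assoc X.act Y.act Z.act)
  leftUnitor X := isoOfLinearEquiv (TensorProduct.lid k X.space) (tensorAct_lid X.act)
  rightUnitor X := isoOfLinearEquiv (TensorProduct.rid k X.space) (tensorAct_rid X.act)

/-- The forgetful functor to vector spaces preserves the monoidal structure on the nose. -/
def forgetInducing : Monoidal.InducingFunctorData (forget (k := k) (H := H)) where
  μIso X Y := Iso.refl _
  εIso := Iso.refl _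
  whiskerLeft_eq X _ _ f := ModuleCat.hom_ext (TensorProduct.ext' fun _ _ => rfl)
  whiskerRight_eq f Y := ModuleCat.hom_ext (TensorProduct.ext' fun _ _ => rfl)
  tensorHom_eq f g := ModuleCat.hom_ext (TensorProduct.ext' fun _ _ => rfl)
  associator_eq X Y Z := ModuleCat.hom_ext (TensorProduct.ext_threefold fun _ _ _ => rfl)
  leftUnitor_eq X := ModuleCat.hom_ext (TensorProduct.ext' fun _ _ => rfl)
  rightUnitor_eq X := ModuleCat.hom_ext (TensorProduct.ext' fun _ _ => rfl)

instance : MonoidalCategory (FDHMod.{u, w} k H) := Monoidal.induced forget forgetInducing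

/-- The braiding `c_{X,Y}` of `H`-modules. -/
def braid (Q : RibbonStructure k H) (X Y : FDHMod.{u, w} k H) : X ⊗ Y ≅ Y ⊗ X :=
  isoOfLinearEquiv
    (LinearEquiv.ofLinearMap (braidMap Q X.act Y.act) (braidInvMap Q Y.act X.act)
      (LinearMap.ext (braidMap_braidInvMap Q X.act Y.act))
      (LinearMap.ext (braidInvMap_braidMap Q X.act Y.act)))
    (braidMap_comm Q X.act Y.act)

/-- The twist `θ_X`: the action of `v⁻¹`. -/
def twist (Q : RibbonStructure k H) (X : FDHMod.{u, w} k H) : X ⟶ X :=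
  ofLinear (X.act (↑(Q.v⁻¹) : H)) fun h => by
    have hc : (↑(Q.v⁻¹) : H) * h = h * (↑(Q.v⁻¹) : H) := by
      rw [Units.inv_mul_eq_iff_eq_mul, ← mul_assoc, Q.v_central, mul_assoc, Units.mul_inv, mul_one]
    rw [← Module.End.mul_eq_comp, ← Module.End.mul_eq_comp, ← map_mul, ← map_mul, hc]

/-- The dual module. -/
def dual (X : FDHMod.{u, w} k H) : FDHMod.{u, w} k H := of (dualAct X.act)

/-- The evaluation `X* ⊗ X ⟶ 1`. -/
def ev (X : FDHMod.{u, w} k H) : X.dual ⊗ X ⟶ 𝟙_ (FDHMod.{u, w} k H) :=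
  ofLinear (contractLeft k X.space) (contractLeft_act X.act)

/-- The coevaluation `1 ⟶ X ⊗ X*`. -/
def coev (X : FDHMod.{u, w} k H) : 𝟙_ (FDHMod.{u, w} k H) ⟶ X ⊗ X.dual :=
  ofLinear (coevaluation k X.space) (coevaluation_act X.act)

/-- The right evaluation `X ⊗ X* ⟶ 1` of the ribbon category of `H`-modules. -/
def evRight (Q : RibbonStructure k H) (X : FDHMod.{u, w} k H) :
    X ⊗ X.dual ⟶ 𝟙_ (FDHMod.{u, w} k H) :=
  (twist Q X ⊗ₘ 𝟙 X.dual) ≫ (braid Q X X.dual).hom ≫ X.ev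

/-- The right coevaluation `1 ⟶ X* ⊗ X` of the ribbon category of `H`-modules. -/
def coevRight (Q : RibbonStructure k H) (X : FDHMod.{u, w} k H) :
    𝟙_ (FDHMod.{u, w} k H) ⟶ X.dual ⊗ X :=
  X.coev ≫ (braid Q X X.dual).hom ≫ (𝟙 X.dual ⊗ₘ twist Q X)

end FDHMod

end Modules

/-! ## The invariants -/

noncomputable section Invariants

variable {k : Type u} {H : Type w} [Field k] [Ring H] [HopfAlgebra k H]

/-- `+` is sent to `X`, `-` is sent to `X*`. -/
def colour (X : FDHMod.{u, w} k H) : OrientationSign → FDHMod.{u, w} k H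
  | .pos => X
  | .neg => X.dual

/-- The `H`-linear maps which the ribbon functor `F_X` attaches to crossings, caps and cups. -/
def ribbonPiece (Q : RibbonStructure k H) (X : FDHMod.{u, w} k H) :
    ∀ {A B : TangleWord}, ClassicalPiece A B → (A.obj (colour X) ⟶ B.obj (colour X))
  | _, _, .over a b => (FDHMod.braid Q (colour X a) (colour X b)).hom
  | _, _, .under a b => (FDHMod.braid Q (colour X b) (colour X a)).inv
  | _, _, .cap .pos .neg _ => X.evRight Q
  | _, _, .cap .neg .pos _ => X.ev
  | _, _, .cup .pos .neg _ => X.coev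
  | _, _, .cup .neg .pos _ => X.coevRight Q

/-- The Reshetikhin–Turaev functor `F_X`, on diagrams: the morphism of the ribbon category of
finite-dimensional `H`-modules attached to a classical tangle diagram coloured by `X`. -/
def reshetikhinTuraev (Q : RibbonStructure k H) (X : FDHMod.{u, w} k H) {A B : TangleWord}
    (D : TangleDiagram ClassicalPiece A B) : A.obj (colour X) ⟶ B.obj (colour X) :=
  D.eval (colour X) (ribbonPiece Q X)

/-- The vector space attached to a letter. -/
def colourSpace (X : FDHMod.{u, w} k H) (a : OrientationSign) : ModuleCat.{u} k :=
  FDHMod.forget.obj (colour X a)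

/-- The linear maps attached to the elementary pieces of virtual diagrams: the linear maps
underlying those attached to the classical pieces, and the flip for a virtual crossing. -/
def virtualPiece (Q : RibbonStructure k H) (X : FDHMod.{u, w} k H) :
    ∀ {A B : TangleWord}, VirtualPiece A B → (A.obj (colourSpace X) ⟶ B.obj (colourSpace X))
  | _, _, .classical (.over a b) => FDHMod.forget.map (ribbonPiece Q X (.over a b))
  | _, _, .classical (.under a b) => FDHMod.forget.map (ribbonPiece Q X (.under a b))
  | _, _, .classical (.cap a b h) => FDHMod.forget.map (ribbonPiece Q X (.cap a b h))
  | _, _, .classical (.cup a b h) => FDHMod.forget.map (ribbonPiece Q X (.cup a b h))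
  | _, _, .virtual a b => (β_ (colourSpace X a) (colourSpace X b)).hom

/-- The functor from virtual tangles to vector spaces, on diagrams. -/
def virtualOperator (Q : RibbonStructure k H) (X : FDHMod.{u, w} k H) {A B : TangleWord}
    (D : TangleDiagram VirtualPiece A B) : A.obj (colourSpace X) ⟶ B.obj (colourSpace X) :=
  D.eval (colourSpace X) (virtualPiece Q X)

/-- The number attached to a virtual link diagram: its operator is an endomorphism of the
one-dimensional space `k`, hence a scalar. -/
def virtualInvariant (Q : RibbonStructure k H) (X : FDHMod.{u, w} k H)
    (D : VirtualLinkDiagram) : k :=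
  ((virtualOperator Q X D : 𝟙_ (ModuleCat.{u} k) ⟶ 𝟙_ (ModuleCat.{u} k)).hom : k →ₗ[k] k) (1 : k)

/-- The number attached to a classical link diagram by the Reshetikhin–Turaev functor: an
endomorphism of the trivial `H`-module `k` is a scalar. -/
def reshetikhinTuraevInvariant (Q : RibbonStructure k H) (X : FDHMod.{u, w} k H)
    (D : LinkDiagram) : k :=
  ((reshetikhinTuraev Q X D :
    𝟙_ (FDHMod.{u, w} k H) ⟶ 𝟙_ (FDHMod.{u, w} k H)).map.hom : k →ₗ[k] k) (1 : k)

end Invariants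

/-! Both evaluations are defined by recursion on a diagram, so they respect the congruence generated
by the moves as soon as they respect each generating move (`TangleDiagram.Equivalent.eval_eq`).
Invariance is thus a finite list of identities between morphisms.

For classical moves the identities live in the category of `H`-modules. Quasi-triangularity of `R =
∑ aᵢ ⊗ bᵢ` makes this category braided, and the second and third Reidemeister moves and the slides
past extrema hold in every braided category. The ribbon element enters in the zigzags and in the
framed first move. Put `g = v⁻¹ u`; since `v² = u S(u)`, the element `v⁻¹ S(u)` inverts its action.
The right evaluation is `x ⊗ f ↦ f (g x)` and the right coevaluation is `∑ eⁱ ⊗ g⁻¹ eᵢ`, whence the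
zigzags. The two curls on `X` act by `∑ bⱼ g aⱼ` and `∑ aⱼ g⁻¹ bⱼ`. Both are `v⁻¹`, because `∑ bⱼ u
aⱼ = 1 = ∑ aⱼ S(u) bⱼ`. So a curl on either side of the strand is the twist, and the dual strand
follows in the same way after `S` is applied.

The flip is in general not `H`-linear, so virtual diagrams are evaluated in vector spaces. The
forgetful functor is monoidal and carries one evaluation to the other (`virtualOperator_toVirtual`);
this transports the classical moves and also gives the comparison on classical links. The moves with
virtual crossings hold because the flip is a symmetry, natural with respect to every linear map,
braidings included (`symmetry_triple`). A curl made with a flip acts on `X` by `g` or `g⁻¹`, so a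
virtual first move would fail in general. -/

/-! ### Identities for the universal `R`-matrix and the Drinfeld element -/

section HopfIdentities

variable {k : Type u} {H : Type w} [Field k] [Ring H] [HopfAlgebra k H]

namespace RibbonStructure

local notation "S" => HopfAlgebra.antipode k (A := H)

variable (Q : RibbonStructure k H) {n : ℕ} {a b : Fin n → H}

theorem sum_comul_left (hR : (Q.R : H ⊗[k] H) = ∑ i, a i ⊗ₜ[k] b i) :
    ∑ i, (Coalgebra.comul (R := k) (a i)) ⊗ₜ[k] b i =
    ∑ i, ∑ j, (a i ⊗ₜ[k] a j) ⊗ₜ[k] (b i * b j) := by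
  have h := Q.comul_left
  simpa [hR, map_sum, Finset.sum_mul_sum] using h

theorem sum_comul_right (hR : (Q.R : H ⊗[k] H) = ∑ i, a i ⊗ₜ[k] b i) :
    ∑ i, a i ⊗ₜ[k] (Coalgebra.comul (R := k) (b i)) =
    ∑ i, ∑ j, (a i * a j) ⊗ₜ[k] (b j ⊗ₜ[k] b i) := by
  have h := Q.comul_right
  simpa [hR, map_sum, Finset.sum_mul_sum] using h

/-- The counit on the first leg of `(Δ ⊗ id)R = R₁₃R₂₃` gives `R = (1 ⊗ e) R` with `e = (ε ⊗ id)R`.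
As `R` is invertible, `1 ⊗ e = 1`, and a second use of the counit isolates `e`. -/
theorem sum_counit_left (hR : (Q.R : H ⊗[k] H) = ∑ i, a i ⊗ₜ[k] b i) :
    ∑ i, Coalgebra.counit (R := k) (a i) • b i = 1 := by
  have h := congrArg (LinearMap.rTensor H ((TensorProduct.lid k H).toLinearMap ∘ₗ
    LinearMap.rTensor H (Coalgebra.counit (R := k) (A := H)))) (Q.sum_comul_left hR)
  simp only [map_sum, LinearMap.rTensor_tmul, LinearMap.comp_apply,
    Coalgebra.rTensor_counit_comul, LinearEquiv.coe_coe, TensorProduct.lid_tmul, one_smul] at h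
  have h' : (Q.R : H ⊗[k] H) =
      (1 ⊗ₜ[k] ∑ i, Coalgebra.counit (R := k) (a i) • b i) * (Q.R : H ⊗[k] H) := by
    conv_lhs => rw [hR, h]
    rw [hR, TensorProduct.tmul_sum, Finset.sum_mul_sum]
    simp [TensorProduct.smul_tmul']
  have h'' := congrArg (· * (↑(Q.R⁻¹) : H ⊗[k] H)) h'
  simp only [Units.mul_inv, mul_assoc, mul_one] at h''
  have h3 := congrArg (fun t => TensorProduct.lid k H
    (LinearMap.rTensor H (Coalgebra.counit (R := k) (A := H)) t)) h''
  simpa [Algebra.TensorProduct.one_def] using h3.symm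

theorem sum_counit_right (hR : (Q.R : H ⊗[k] H) = ∑ i, a i ⊗ₜ[k] b i) :
    ∑ i, Coalgebra.counit (R := k) (b i) • a i = 1 := by
  have h := congrArg (LinearMap.lTensor H ((TensorProduct.lid k H).toLinearMap ∘ₗ
    LinearMap.rTensor H (Coalgebra.counit (R := k) (A := H)))) (Q.sum_comul_right hR)
  simp only [map_sum, LinearMap.lTensor_tmul, LinearMap.comp_apply,
    Coalgebra.rTensor_counit_comul, LinearEquiv.coe_coe, TensorProduct.lid_tmul, one_smul,
    LinearMap.rTensor_tmul] at h
  have h' : (Q.R : H ⊗[k] H) = (Q.R : H ⊗[k] H) *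
      ((∑ i, Coalgebra.counit (R := k) (b i) • a i) ⊗ₜ[k] 1) := by
    conv_lhs => rw [hR, h]
    rw [hR, TensorProduct.sum_tmul, Finset.sum_mul_sum]
    simp [TensorProduct.smul_tmul']
  have h'' := congrArg ((↑(Q.R⁻¹) : H ⊗[k] H) * ·) h'
  simp only [Units.inv_mul, ← mul_assoc, one_mul] at h''
  have h3 := congrArg (fun t => TensorProduct.rid k H
    (LinearMap.lTensor H (Coalgebra.counit (R := k) (A := H)) t)) h''
  simpa [Algebra.TensorProduct.one_def] using h3.symm

/-- Convolving with the antipode, `m (S ⊗ id) Δ = ε`, collapses the first two legs of `(Δ ⊗ id)R =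
R₁₃R₂₃`. This exhibits `(S ⊗ id)R` as a left inverse of `R`, hence as `R⁻¹`. -/
theorem sum_antipode_mul_left (hR : (Q.R : H ⊗[k] H) = ∑ i, a i ⊗ₜ[k] b i) :
    ∑ i, ∑ j, (S (a i) * a j) ⊗ₜ[k] (b i * b j) = 1 := by
  have h := congrArg (LinearMap.rTensor H (LinearMap.mul' k H ∘ₗ LinearMap.rTensor H S))
    (Q.sum_comul_left hR)
  simp only [map_sum, LinearMap.rTensor_tmul, LinearMap.comp_apply,
    HopfAlgebra.mul_antipode_rTensor_comul_apply, LinearMap.mul'_apply] at h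
  have h1 := congrArg (fun t => (1 : H) ⊗ₜ[k] t) (Q.sum_counit_left hR)
  simp only [TensorProduct.tmul_sum] at h1
  rw [← h, Algebra.TensorProduct.one_def, ← h1]
  simp [Algebra.algebraMap_eq_smul_one, TensorProduct.smul_tmul']

/-- The mirror argument on `(id ⊗ Δ)R = R₁₃R₁₂`. The order of the second factors makes this a
statement about inverses in `H ⊗ Hᵐᵒᵖ` rather than in `H ⊗ H`. -/
theorem sum_mul_antipode_right (hR : (Q.R : H ⊗[k] H) = ∑ i, a i ⊗ₜ[k] b i) :
    ∑ i, ∑ j, (a i * a j) ⊗ₜ[k] (b j * S (b i)) = 1 := by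
  have h := congrArg (LinearMap.lTensor H (LinearMap.mul' k H ∘ₗ LinearMap.lTensor H S))
    (Q.sum_comul_right hR)
  simp only [map_sum, LinearMap.lTensor_tmul, LinearMap.comp_apply,
    HopfAlgebra.mul_antipode_lTensor_comul_apply, LinearMap.mul'_apply] at h
  have h1 := congrArg (fun t => t ⊗ₜ[k] (1 : H)) (Q.sum_counit_right hR)
  simp only [TensorProduct.sum_tmul] at h1
  rw [← h, Algebra.TensorProduct.one_def, ← h1]
  simp [Algebra.algebraMap_eq_smul_one, TensorProduct.smul_tmul']

theorem inv_eq_sum (hR : (Q.R : H ⊗[k] H) = ∑ i, a i ⊗ₜ[k] b i) :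
    (↑(Q.R⁻¹) : H ⊗[k] H) = ∑ i, S (a i) ⊗ₜ[k] b i := by
  refine Units.inv_eq_of_mul_eq_one_left ?_
  rw [hR, Finset.sum_mul_sum, ← Q.sum_antipode_mul_left hR]
  simp

/-- In `H ⊗ Hᵐᵒᵖ` the element `(id ⊗ S)R` has `(S ⊗ S)R` as left inverse, by applying `id ⊗ S` to
`R⁻¹R = 1`, and `R` as right inverse, by `sum_mul_antipode_right`. The two inverses therefore agree.
-/
theorem sum_antipode_antipode (hR : (Q.R : H ⊗[k] H) = ∑ i, a i ⊗ₜ[k] b i) :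
    ∑ i, S (a i) ⊗ₜ[k] S (b i) = ∑ i, a i ⊗ₜ[k] b i := by
  let e : H ⊗[k] H ≃ₗ[k] H ⊗[k] Hᵐᵒᵖ :=
    TensorProduct.congr (LinearEquiv.refl k H) (MulOpposite.opLinearEquiv k)
  apply e.injective
  refine left_inv_eq_right_inv (a := e (∑ i, a i ⊗ₜ[k] S (b i))) ?_ ?_
  · have h : (↑(Q.R⁻¹) : H ⊗[k] H) * Q.R = 1 := Units.inv_mul _
    rw [Q.inv_eq_sum hR, hR, Finset.sum_mul_sum] at h
    have h' := congrArg (fun t => e (LinearMap.lTensor H S t)) h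
    simpa [e, Algebra.TensorProduct.one_def, HopfAlgebra.antipode_mul_antidistrib,
      HopfAlgebra.antipode_one, Finset.sum_mul_sum] using h'
  · have h' := congrArg e (Q.sum_mul_antipode_right hR)
    simpa [e, Algebra.TensorProduct.one_def, Finset.sum_mul_sum] using h'

/-- Directly `S(u) = ∑ S(aᵢ) S²(bᵢ)`; the invariance of `R` under `S ⊗ S` removes one antipode from
each factor. -/
theorem antipode_sum_antipode_mul (hR : (Q.R : H ⊗[k] H) = ∑ i, a i ⊗ₜ[k] b i) :
    S (∑ i, S (b i) * a i) = ∑ i, a i * S (b i) := by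
  have := congrArg (fun t => LinearMap.mul' k H (LinearMap.lTensor H S t))
    (Q.sum_antipode_antipode hR)
  simpa [HopfAlgebra.antipode_mul_antidistrib] using this

theorem v_sq_eq_sum (hR : (Q.R : H ⊗[k] H) = ∑ i, a i ⊗ₜ[k] b i) :
    (Q.v : H) ^ 2 = (∑ i, S (b i) * a i) * ∑ i, a i * S (b i) := by
  rw [← Q.antipode_sum_antipode_mul hR]
  simpa [hR] using Q.v_sq

/-- Multiplying the legs of `sum_mul_antipode_right` in reverse order produces `∑ bⱼ S(bᵢ) aᵢ aⱼ`,
with `u` in the middle. The three lemmas that follow come from this one by applying `S` or replacing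
`R` by `(S ⊗ S)R`; together they evaluate the four curls. -/
theorem sum_mul_drinfeld_mul (hR : (Q.R : H ⊗[k] H) = ∑ i, a i ⊗ₜ[k] b i) :
    ∑ j, b j * (∑ i, S (b i) * a i) * a j = 1 := by
  have h := congrArg (fun t => LinearMap.mul' k H (TensorProduct.comm k H H t))
    (Q.sum_mul_antipode_right hR)
  simp only [map_sum, TensorProduct.comm_tmul, LinearMap.mul'_apply,
    Algebra.TensorProduct.one_def, mul_one] at h
  rw [← h, Finset.sum_comm]
  simp only [Finset.mul_sum, Finset.sum_mul, mul_assoc]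

theorem sum_antipode_mul_antipode_drinfeld_mul (hR : (Q.R : H ⊗[k] H) = ∑ i, a i ⊗ₜ[k] b i) :
   
    ∑ j, S (a j) * (∑ i, a i * S (b i)) * S (b j) = 1 := by
  rw [← Q.antipode_sum_antipode_mul hR, ← HopfAlgebra.antipode_one (R := k),
    ← Q.sum_mul_drinfeld_mul hR]
  simp only [map_sum, HopfAlgebra.antipode_mul_antidistrib, mul_assoc]

theorem sum_antipode_mul_drinfeld_mul (hR : (Q.R : H ⊗[k] H) = ∑ i, a i ⊗ₜ[k] b i) :
   
    ∑ j, S (b j) * (∑ i, S (b i) * a i) * S (a j) = 1 := by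
  rw [← Q.sum_mul_drinfeld_mul hR]
  have h := congrArg (fun t => LinearMap.mul' k H (LinearMap.rTensor H
    (LinearMap.mulRight k (∑ i, S (b i) * a i)) (TensorProduct.comm k H H t)))
    (Q.sum_antipode_antipode hR)
  simpa only [map_sum, TensorProduct.comm_tmul, LinearMap.rTensor_tmul, LinearMap.mul'_apply,
    LinearMap.mulRight_apply] using h

theorem sum_mul_antipode_drinfeld_mul (hR : (Q.R : H ⊗[k] H) = ∑ i, a i ⊗ₜ[k] b i) :
    ∑ j, a j * (∑ i, a i * S (b i)) * b j = 1 := by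
  rw [← Q.sum_antipode_mul_antipode_drinfeld_mul hR]
  have h := congrArg (fun t => LinearMap.mul' k H (LinearMap.rTensor H
    (LinearMap.mulRight k (∑ i, a i * S (b i))) t)) (Q.sum_antipode_antipode hR)
  simpa only [map_sum, LinearMap.rTensor_tmul, LinearMap.mul'_apply,
    LinearMap.mulRight_apply] using h.symm

end RibbonStructure
end HopfIdentities

/-! ### The braided category of finite-dimensional modules -/

noncomputable section Braiding

variable {k : Type u} {H : Type w} [Field k] [Ring H] [HopfAlgebra k H]
variable {V W U V' W' : Type u} [AddCommGroup V] [Module k V] [AddCommGroup W] [Module k W]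
  [AddCommGroup U] [Module k U] [AddCommGroup V'] [Module k V'] [AddCommGroup W'] [Module k W']

theorem act₂_sum_tmul (ρ : H →ₐ[k] Module.End k V) (σ : H →ₐ[k] Module.End k W) {n : ℕ}
    (a b : Fin n → H) (x : V) (y : W) :
    act₂ ρ σ (∑ i, a i ⊗ₜ[k] b i) (x ⊗ₜ y) = ∑ i, ρ (a i) x ⊗ₜ[k] σ (b i) y := by
  simp only [map_sum, LinearMap.sum_apply, act₂_tmul, TensorProduct.map_tmul]

theorem braidMap_tmul (Q : RibbonStructure k H) {n : ℕ} {a b : Fin n → H}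
    (hR : (Q.R : H ⊗[k] H) = ∑ i, a i ⊗ₜ[k] b i)
    (ρ : H →ₐ[k] Module.End k V) (σ : H →ₐ[k] Module.End k W) (x : V) (y : W) :
    braidMap Q ρ σ (x ⊗ₜ y) = ∑ i, σ (b i) y ⊗ₜ[k] ρ (a i) x := by
  rw [braidMap, hR, LinearMap.comp_apply, act₂_sum_tmul]
  simp only [LinearEquiv.coe_coe, map_sum, TensorProduct.comm_tmul]

theorem braidMap_natural (Q : RibbonStructure k H) {ρ : H →ₐ[k] Module.End k V}
    {σ : H →ₐ[k] Module.End k W} {ρ' : H →ₐ[k] Module.End k V'} {σ' : H →ₐ[k] Module.End k W'}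
    {f : V →ₗ[k] V'} {g : W →ₗ[k] W'} (hf : ∀ h, f ∘ₗ ρ h = ρ' h ∘ₗ f)
    (hg : ∀ h, g ∘ₗ σ h = σ' h ∘ₗ g) :
    braidMap Q ρ' σ' ∘ₗ TensorProduct.map f g = TensorProduct.map g f ∘ₗ braidMap Q ρ σ := by
  rw [braidMap, LinearMap.comp_assoc, ← act₂_natural hf hg, ← LinearMap.comp_assoc, braidMap,
    ← LinearMap.comp_assoc]
  congr 1
  exact TensorProduct.ext' fun _ _ => rfl

theorem braidMap_tensor_right (Q : RibbonStructure k H) {n : ℕ} {a b : Fin n → H}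
    (hR : (Q.R : H ⊗[k] H) = ∑ i, a i ⊗ₜ[k] b i) (ρ : H →ₐ[k] Module.End k V)
    (σ : H →ₐ[k] Module.End k W) (τ : H →ₐ[k] Module.End k U) (x : V) (y : W) (z : U) :
    braidMap Q ρ (tensorAct σ τ) (x ⊗ₜ (y ⊗ₜ z)) =
      ∑ i, ∑ j, (σ (b j) y ⊗ₜ[k] τ (b i) z) ⊗ₜ[k] ρ (a i) (ρ (a j) x) := by
  -- Letting the three legs act on the fixed vectors `x`, `y`, `z` turns the identity for `(id ⊗
  -- Δ)R` into a formula for the braiding; this is one hexagon.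
  let Φ : H ⊗[k] (H ⊗[k] H) →ₗ[k] (W ⊗[k] U) ⊗[k] V :=
    (TensorProduct.comm k V (W ⊗[k] U)).toLinearMap ∘ₗ
      LinearMap.applyₗ (R := k) (x ⊗ₜ[k] (y ⊗ₜ[k] z)) ∘ₗ
      (Module.endTensorEndAlgHom (R := k) (S := k) (A := k)).toLinearMap ∘ₗ
      (Algebra.TensorProduct.map ρ (act₂ σ τ)).toLinearMap
  have hΦ : ∀ (c : H) (t : H ⊗[k] H),
      Φ (c ⊗ₜ t) = act₂ σ τ t (y ⊗ₜ z) ⊗ₜ[k] ρ c x := fun _ _ => rfl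
  have h := congrArg Φ (Q.sum_comul_right hR)
  simp only [map_sum, hΦ, act₂_tmul, TensorProduct.map_tmul, map_mul, Module.End.mul_apply] at h
  rw [braidMap_tmul Q hR]
  exact h

theorem braidMap_tensor_left (Q : RibbonStructure k H) {n : ℕ} {a b : Fin n → H}
    (hR : (Q.R : H ⊗[k] H) = ∑ i, a i ⊗ₜ[k] b i) (ρ : H →ₐ[k] Module.End k V)
    (σ : H →ₐ[k] Module.End k W) (τ : H →ₐ[k] Module.End k U) (x : V) (y : W) (z : U) :
    braidMap Q (tensorAct ρ σ) τ ((x ⊗ₜ y) ⊗ₜ z) =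
      ∑ i, ∑ j, τ (b i) (τ (b j) z) ⊗ₜ[k] (ρ (a i) x ⊗ₜ[k] σ (a j) y) := by
  let Φ : (H ⊗[k] H) ⊗[k] H →ₗ[k] U ⊗[k] (V ⊗[k] W) :=
    (TensorProduct.comm k (V ⊗[k] W) U).toLinearMap ∘ₗ
      LinearMap.applyₗ (R := k) ((x ⊗ₜ[k] y) ⊗ₜ[k] z) ∘ₗ
      (Module.endTensorEndAlgHom (R := k) (S := k) (A := k)).toLinearMap ∘ₗ
      (Algebra.TensorProduct.map (act₂ ρ σ) τ).toLinearMap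
  have hΦ : ∀ (t : H ⊗[k] H) (c : H),
      Φ (t ⊗ₜ c) = τ c z ⊗ₜ[k] act₂ ρ σ t (x ⊗ₜ y) := fun _ _ => rfl
  have h := congrArg Φ (Q.sum_comul_left hR)
  simp only [map_sum, hΦ, act₂_tmul, TensorProduct.map_tmul, map_mul, Module.End.mul_apply] at h
  rw [braidMap_tmul Q hR]
  exact h

namespace FDHMod

theorem hom_ext_linear {X Y : FDHMod.{u, w} k H} {f g : X ⟶ Y}
    (h : f.map.hom = g.map.hom) : f = g :=
  Hom.ext (ModuleCat.hom_ext h)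

/-- The braided structure on finite-dimensional modules given by the universal `R`-matrix. -/
abbrev braided (Q : RibbonStructure k H) : BraidedCategory (FDHMod.{u, w} k H) where
  braiding := braid Q
  braiding_naturality_right X _ _ f :=
    hom_ext_linear (braidMap_natural Q (fun _ => rfl) f.comm)
  braiding_naturality_left f Z :=
    hom_ext_linear (braidMap_natural Q f.comm (fun _ => rfl))
  hexagon_forward X Y Z := by
    obtain ⟨n, a, b, hR⟩ := TensorProduct.exists_sum_tmul_eq (Q.R : H ⊗[k] H)
    refine hom_ext_linear (TensorProduct.ext_threefold fun x y z => ?_)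
    change TensorProduct.assoc k Y.space Z.space X.space
        (braidMap Q X.act (tensorAct Y.act Z.act) (x ⊗ₜ (y ⊗ₜ z))) =
      TensorProduct.map LinearMap.id (braidMap Q X.act Z.act)
        (TensorProduct.assoc k Y.space X.space Z.space (braidMap Q X.act Y.act (x ⊗ₜ y) ⊗ₜ z))
    rw [braidMap_tensor_right Q hR, braidMap_tmul Q hR]
    simp only [map_sum, TensorProduct.sum_tmul, TensorProduct.assoc_tmul, TensorProduct.map_tmul,
      braidMap_tmul Q hR, TensorProduct.tmul_sum, LinearMap.id_apply]
    exact Finset.sum_comm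
  hexagon_reverse X Y Z := by
    obtain ⟨n, a, b, hR⟩ := TensorProduct.exists_sum_tmul_eq (Q.R : H ⊗[k] H)
    -- Precomposing with the associator makes the source `(X ⊗ Y) ⊗ Z`, where
    -- `TensorProduct.ext_threefold` applies.
    refine (cancel_epi (α_ X Y Z).hom).1 ?_
    rw [Iso.hom_inv_id_assoc]
    refine hom_ext_linear (TensorProduct.ext_threefold fun x y z => ?_)
    change (TensorProduct.assoc k Z.space X.space Y.space).symm
        (braidMap Q (tensorAct X.act Y.act) Z.act ((x ⊗ₜ y) ⊗ₜ z)) =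
      TensorProduct.map (braidMap Q X.act Z.act) LinearMap.id
        ((TensorProduct.assoc k X.space Z.space Y.space).symm
          (x ⊗ₜ braidMap Q Y.act Z.act (y ⊗ₜ z)))
    rw [braidMap_tensor_left Q hR, braidMap_tmul Q hR]
    simp only [map_sum, TensorProduct.tmul_sum, TensorProduct.assoc_symm_tmul,
      TensorProduct.map_tmul, braidMap_tmul Q hR, TensorProduct.sum_tmul, LinearMap.id_apply]
    exact Finset.sum_comm

end FDHMod
end Braiding

/-! ### From local moves to equivalence of diagrams -/

section Evaluation

variable {C : Type*} [Category C] [MonoidalCategory C]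

/-- Evaluation respects equivalence of diagrams as soon as it respects the local moves. -/
theorem TangleDiagram.Equivalent.eval_eq {P : TangleWord → TangleWord → Type}
    {M : ∀ X Y : TangleWord, TangleDiagram P X Y → TangleDiagram P X Y → Prop}
    (c : OrientationSign → C) (φ : ∀ {X Y : TangleWord}, P X Y → (X.obj c ⟶ Y.obj c))
    (hM : ∀ {X Y : TangleWord} {f g : TangleDiagram P X Y}, M X Y f g → f.eval c φ = g.eval c φ)
    {X Y : TangleWord} {f g : TangleDiagram P X Y} (h : Equivalent M f g) :
    f.eval c φ = g.eval c φ := by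
  induction h with
  | move h => exact hM h
  | refl f => rfl
  | symm _ ih => exact ih.symm
  | trans _ _ ih₁ ih₂ => exact ih₁.trans ih₂
  | comp_congr _ _ ih₁ ih₂ => simp only [eval, ih₁, ih₂]
  | tensor_congr _ _ ih₁ ih₂ => exact congrArg₂ (· ⊗ₘ ·) ih₁ ih₂
  | pentagon W X Y Z => simp [eval, TangleWord.obj]
  -- What remains are the axioms of a monoidal category, which hold in the target.
  | _ => simp [eval, TangleWord.obj]

end Evaluation

/-! ### Slides past extrema and the third move in a braided category -/

section Braided

variable {C : Type*} [Category C] [MonoidalCategory C] [BraidedCategory C]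

/-- Naturality of the braiding moves `c` past the whole of `f`. The hexagon splits the braiding of
`c` with `a ⊗ b`, the braiding with the unit is trivial, and the crossing with `a` is carried to the
other side as an inverse. The other three slides are variants. -/
theorem braiding_cap_slide_over {a b : C} (c : C) (f : a ⊗ b ⟶ 𝟙_ C) :
    (α_ a c b).hom ≫ (𝟙 a ⊗ₘ (β_ c b).hom) ≫ (α_ a b c).inv ≫ (f ⊗ₘ 𝟙 c) ≫ (λ_ c).hom =
      ((β_ c a).inv ⊗ₘ 𝟙 b) ≫ (α_ c a b).hom ≫ (𝟙 c ⊗ₘ f) ≫ (ρ_ c).hom := by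
  have h := BraidedCategory.braiding_naturality_right c f
  have h' := (α_ c a b).hom ≫= h =≫ (λ_ c).hom
  rw [← cancel_epi ((β_ c a).hom ▷ b)]
  simp at h' ⊢
  exact h'.symm

theorem braiding_cap_slide_under {a b : C} (c : C) (f : a ⊗ b ⟶ 𝟙_ C) :
    (α_ a c b).hom ≫ (𝟙 a ⊗ₘ (β_ b c).inv) ≫ (α_ a b c).inv ≫ (f ⊗ₘ 𝟙 c) ≫ (λ_ c).hom =
      ((β_ a c).hom ⊗ₘ 𝟙 b) ≫ (α_ c a b).hom ≫ (𝟙 c ⊗ₘ f) ≫ (ρ_ c).hom := by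
  have h := BraidedCategory.braiding_naturality_left f c
  have h' := (α_ a b c).inv ≫= h =≫ (ρ_ c).hom
  rw [← cancel_epi ((α_ a c b).inv), ← cancel_epi (a ◁ (β_ b c).hom)]
  simp at h' ⊢
  exact h'

theorem braiding_cup_slide_over {a b : C} (c : C) (f : 𝟙_ C ⟶ a ⊗ b) :
    (λ_ c).inv ≫ (f ⊗ₘ 𝟙 c) ≫ (α_ a b c).hom ≫ (𝟙 a ⊗ₘ (β_ c b).inv) ≫ (α_ a c b).inv =
      (ρ_ c).inv ≫ (𝟙 c ⊗ₘ f) ≫ (α_ c a b).inv ≫ ((β_ c a).hom ⊗ₘ 𝟙 b) := by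
  have h := BraidedCategory.braiding_naturality_right c f
  have h' := (ρ_ c).inv ≫= h =≫ (α_ a b c).hom
  rw [← cancel_mono ((α_ a c b).hom), ← cancel_mono (a ◁ (β_ c b).hom)]
  simp at h' ⊢
  exact h'.symm

theorem braiding_cup_slide_under {a b : C} (c : C) (f : 𝟙_ C ⟶ a ⊗ b) :
    (λ_ c).inv ≫ (f ⊗ₘ 𝟙 c) ≫ (α_ a b c).hom ≫ (𝟙 a ⊗ₘ (β_ b c).hom) ≫ (α_ a c b).inv =
      (ρ_ c).inv ≫ (𝟙 c ⊗ₘ f) ≫ (α_ c a b).inv ≫ ((β_ a c).inv ⊗ₘ 𝟙 b) := by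
  have h := BraidedCategory.braiding_naturality_left f c
  have h' := (λ_ c).inv ≫= h =≫ (α_ c a b).inv
  rw [← cancel_mono ((β_ a c).hom ▷ b)]
  simp at h' ⊢
  exact h'

/-- This is the Yang–Baxter equation, rebracketed at both ends. -/
theorem braiding_triple (a b c : C) :
    ((β_ a b).hom ⊗ₘ 𝟙 c) ≫ (α_ b a c).hom ≫ (𝟙 b ⊗ₘ (β_ a c).hom) ≫ (α_ b c a).inv ≫
        ((β_ b c).hom ⊗ₘ 𝟙 a) =
      (α_ a b c).hom ≫ (𝟙 a ⊗ₘ (β_ b c).hom) ≫ (α_ a c b).inv ≫ ((β_ a c).hom ⊗ₘ 𝟙 b) ≫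
        (α_ c a b).hom ≫ (𝟙 c ⊗ₘ (β_ a b).hom) ≫ (α_ c b a).inv := by
  have h := (α_ a b c).hom ≫= BraidedCategory.yang_baxter a b c =≫ (α_ c b a).inv
  simp at h ⊢
  exact h

end Braided

/-! ### The pivotal element and the right duality maps -/

noncomputable section Duality

variable {k : Type u} {H : Type w} [Field k] [Ring H] [HopfAlgebra k H]

namespace RibbonStructure

local notation "S" => HopfAlgebra.antipode k (A := H)

/-- The pivotal element `v⁻¹ u`. -/
def pivot (Q : RibbonStructure k H) : H :=
  (↑(Q.v⁻¹) : H) *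
    LinearMap.mul' k H (LinearMap.rTensor H S (TensorProduct.comm k H H (Q.R : H ⊗[k] H)))

/-- The inverse `v⁻¹ S(u)` of the pivotal element. -/
def pivotInv (Q : RibbonStructure k H) : H :=
  (↑(Q.v⁻¹) : H) * LinearMap.mul' k H (LinearMap.lTensor H S (Q.R : H ⊗[k] H))

variable (Q : RibbonStructure k H) {n : ℕ} {a b : Fin n → H}

theorem pivot_eq (hR : (Q.R : H ⊗[k] H) = ∑ i, a i ⊗ₜ[k] b i) :
    Q.pivot = (↑(Q.v⁻¹) : H) * ∑ i, S (b i) * a i := by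
  simp [pivot, hR]

theorem pivotInv_eq (hR : (Q.R : H ⊗[k] H) = ∑ i, a i ⊗ₜ[k] b i) :
    Q.pivotInv = (↑(Q.v⁻¹) : H) * ∑ i, a i * S (b i) := by
  simp [pivotInv, hR]

theorem v_inv_comm (h : H) : (↑(Q.v⁻¹) : H) * h = h * (↑(Q.v⁻¹) : H) := by
  rw [Units.inv_mul_eq_iff_eq_mul, ← mul_assoc, Q.v_central, mul_assoc, Units.mul_inv, mul_one]

theorem mul_v_inv_mul (x y z : H) :
    x * ((↑(Q.v⁻¹) : H) * y) * z = (↑(Q.v⁻¹) : H) * (x * y * z) := by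
  rw [← mul_assoc x, ← Q.v_inv_comm x]
  simp only [mul_assoc]

theorem pivot_mul_pivotInv : Q.pivot * Q.pivotInv = 1 := by
  obtain ⟨n, a, b, hR⟩ := TensorProduct.exists_sum_tmul_eq (Q.R : H ⊗[k] H)
  have h := Q.v_sq_eq_sum hR
  rw [Q.pivot_eq hR, Q.pivotInv_eq hR, mul_assoc, ← mul_assoc (∑ i, S (b i) * a i),
    ← Q.v_inv_comm, mul_assoc (↑(Q.v⁻¹) : H), ← h, sq, Units.inv_mul_cancel_left,
    Units.inv_mul]

theorem sum_mul_pivot_mul (hR : (Q.R : H ⊗[k] H) = ∑ i, a i ⊗ₜ[k] b i) :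
    ∑ j, b j * Q.pivot * a j = (↑(Q.v⁻¹) : H) := by
  simp only [Q.pivot_eq hR, Q.mul_v_inv_mul]
  rw [← Finset.mul_sum, Q.sum_mul_drinfeld_mul hR, mul_one]

theorem sum_mul_pivotInv_mul (hR : (Q.R : H ⊗[k] H) = ∑ i, a i ⊗ₜ[k] b i) :
    ∑ j, a j * Q.pivotInv * b j = (↑(Q.v⁻¹) : H) := by
  simp only [Q.pivotInv_eq hR, Q.mul_v_inv_mul]
  rw [← Finset.mul_sum, Q.sum_mul_antipode_drinfeld_mul hR, mul_one]

theorem sum_antipode_mul_pivot_mul (hR : (Q.R : H ⊗[k] H) = ∑ i, a i ⊗ₜ[k] b i) :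
    ∑ j, S (b j) * Q.pivot * S (a j) = (↑(Q.v⁻¹) : H) := by
  simp only [Q.pivot_eq hR, Q.mul_v_inv_mul]
  rw [← Finset.mul_sum, Q.sum_antipode_mul_drinfeld_mul hR, mul_one]

theorem sum_antipode_mul_pivotInv_mul (hR : (Q.R : H ⊗[k] H) = ∑ i, a i ⊗ₜ[k] b i) :
    ∑ j, S (a j) * Q.pivotInv * S (b j) = (↑(Q.v⁻¹) : H) := by
  simp only [Q.pivotInv_eq hR, Q.mul_v_inv_mul]
  rw [← Finset.mul_sum, Q.sum_antipode_mul_antipode_drinfeld_mul hR, mul_one]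

end RibbonStructure

namespace FDHMod

variable (Q : RibbonStructure k H) (X : FDHMod.{u, w} k H)

theorem act_pivot_pivotInv (x : X.space) : X.act Q.pivot (X.act Q.pivotInv x) = x := by
  rw [← Module.End.mul_apply, ← map_mul, Q.pivot_mul_pivotInv, map_one, Module.End.one_apply]

/-- Only one order of the product is computed in `H`; on a finite-dimensional space a one-sided
inverse is two-sided. -/
theorem act_pivotInv_pivot (x : X.space) : X.act Q.pivotInv (X.act Q.pivot x) = x := by
  have h : X.act Q.pivot * X.act Q.pivotInv = 1 := by
    rw [← map_mul, Q.pivot_mul_pivotInv, map_one]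
  exact LinearMap.congr_fun (mul_eq_one_comm.1 h) x

/-- A basis of the underlying space. -/
abbrev basis : Module.Basis (Module.Basis.ofVectorSpaceIndex k X.space) k X.space :=
  Module.Basis.ofVectorSpace k X.space

theorem sum_coord_smul (x : X.space) : ∑ i, X.basis.coord i x • X.basis i = x :=
  X.basis.sum_repr x

theorem sum_smul_coord (f : Module.Dual k X.space) : ∑ i, f (X.basis i) • X.basis.coord i = f := by
  ext x
  conv_rhs => rw [← X.sum_coord_smul x]
  simp [mul_comm]

/-- The linear map underlying the right evaluation. -/
def evRightMap : X.space ⊗[k] Module.Dual k X.space →ₗ[k] k := (X.evRight Q).map.hom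

/-- The linear map underlying the right coevaluation. -/
def coevRightMap : k →ₗ[k] Module.Dual k X.space ⊗[k] X.space := (X.coevRight Q).map.hom

/-- The braiding lets `bᵢ` act on `f`, that is, `S(bᵢ)` on the argument, so the contraction
assembles `∑ S(bᵢ) aᵢ v⁻¹ = v⁻¹ u`. -/
theorem evRightMap_tmul (x : X.space) (f : Module.Dual k X.space) :
    X.evRightMap Q (x ⊗ₜ[k] f) = f (X.act Q.pivot x) := by
  obtain ⟨n, a, b, hR⟩ := TensorProduct.exists_sum_tmul_eq (Q.R : H ⊗[k] H)
  change contractLeft k X.space (braidMap Q X.act (dualAct X.act)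
    (X.act (↑(Q.v⁻¹) : H) x ⊗ₜ[k] f)) = _
  rw [braidMap_tmul Q hR, Q.pivot_eq hR, Q.v_inv_comm]
  simp only [map_sum, contractLeft_apply, dualAct_apply, map_mul, Module.End.mul_apply,
    LinearMap.sum_apply]

/-- The canonical element `∑ eⁱ ⊗ eᵢ` lets an operator on one factor pass to its transpose on the
other; expanding both sides in the basis gives the same double sum. -/
theorem sum_dualAct_coord (h : H) (A : Module.End k X.space) :
    ∑ i, dualAct X.act h (X.basis.coord i) ⊗ₜ[k] A (X.basis i) =
      ∑ i, X.basis.coord i ⊗ₜ[k] A (X.act (HopfAlgebra.antipode k h) (X.basis i)) := by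
  have h₁ : ∀ i, dualAct X.act h (X.basis.coord i) = ∑ j,
      X.basis.coord i (X.act (HopfAlgebra.antipode k h) (X.basis j)) • X.basis.coord j :=
    fun i => (X.sum_smul_coord _).symm
  have h₂ : ∀ i, A (X.act (HopfAlgebra.antipode k h) (X.basis i)) = ∑ j,
      X.basis.coord j (X.act (HopfAlgebra.antipode k h) (X.basis i)) • A (X.basis j) := by
    intro i
    conv_lhs => rw [← X.sum_coord_smul (X.act (HopfAlgebra.antipode k h) (X.basis i))]
    simp only [map_sum, map_smul]
  simp only [h₁, h₂, TensorProduct.sum_tmul, TensorProduct.tmul_sum, TensorProduct.smul_tmul]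
  exact Finset.sum_comm

theorem coevRightMap_one : X.coevRightMap Q 1 =
    ∑ i, X.basis.coord i ⊗ₜ[k] X.act Q.pivotInv (X.basis i) := by
  obtain ⟨n, a, b, hR⟩ := TensorProduct.exists_sum_tmul_eq (Q.R : H ⊗[k] H)
  change TensorProduct.map LinearMap.id (X.act (↑(Q.v⁻¹) : H))
    (braidMap Q X.act (dualAct X.act) (coevaluation k X.space 1)) = _
  rw [coevaluation_apply_one, Q.pivotInv_eq hR]
  simp only [map_sum, braidMap_tmul Q hR, TensorProduct.map_tmul, LinearMap.id_apply, map_mul,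
    Module.End.mul_apply, LinearMap.sum_apply, TensorProduct.tmul_sum]
  refine Finset.sum_comm.trans ((Finset.sum_congr rfl fun j _ =>
    X.sum_dualAct_coord (b j) (X.act (↑(Q.v⁻¹) : H) * X.act (a j))).trans
      Finset.sum_comm)

end FDHMod
end Duality

/-! ### Zigzags and curls -/

section Moves

variable {k : Type u} {H : Type w} [Field k] [Ring H] [HopfAlgebra k H]

namespace FDHMod

variable (Q : RibbonStructure k H) (X : FDHMod.{u, w} k H)

theorem zigzag_coevRight_evRight :
    (ρ_ X).inv ≫ (𝟙 X ⊗ₘ X.coevRight Q) ≫ (α_ X X.dual X).inv ≫ (X.evRight Q ⊗ₘ 𝟙 X) ≫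
      (λ_ X).hom = 𝟙 X := by
  refine hom_ext_linear (LinearMap.ext fun x => ?_)
  change TensorProduct.lid k X.space (TensorProduct.map (X.evRightMap Q) LinearMap.id
    ((TensorProduct.assoc k X.space (Module.Dual k X.space) X.space).symm
      (x ⊗ₜ X.coevRightMap Q 1))) = x
  rw [coevRightMap_one]
  simp only [TensorProduct.tmul_sum, map_sum, TensorProduct.assoc_symm_tmul,
    TensorProduct.map_tmul, evRightMap_tmul, LinearMap.id_apply, TensorProduct.lid_tmul]
  simp only [← map_smul, ← map_sum]
  rw [X.sum_coord_smul, X.act_pivotInv_pivot Q]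

theorem zigzag_coev_ev_dual :
    (ρ_ X.dual).inv ≫ (𝟙 X.dual ⊗ₘ X.coev) ≫ (α_ X.dual X X.dual).inv ≫
      (X.ev ⊗ₘ 𝟙 X.dual) ≫ (λ_ X.dual).hom = 𝟙 X.dual := by
  refine hom_ext_linear (LinearMap.ext fun (f : Module.Dual k X.space) => ?_)
  change TensorProduct.lid k (Module.Dual k X.space)
    (TensorProduct.map (contractLeft k X.space) LinearMap.id
      ((TensorProduct.assoc k (Module.Dual k X.space) X.space (Module.Dual k X.space)).symm
        (f ⊗ₜ coevaluation k X.space 1))) = f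
  rw [coevaluation_apply_one]
  simp only [TensorProduct.tmul_sum, map_sum, TensorProduct.assoc_symm_tmul,
    TensorProduct.map_tmul, contractLeft_apply, LinearMap.id_apply, TensorProduct.lid_tmul]
  exact X.sum_smul_coord f

theorem zigzag_coev_ev :
    (λ_ X).inv ≫ (X.coev ⊗ₘ 𝟙 X) ≫ (α_ X X.dual X).hom ≫ (𝟙 X ⊗ₘ X.ev) ≫ (ρ_ X).hom =
      𝟙 X := by
  refine hom_ext_linear (LinearMap.ext fun x => ?_)
  change TensorProduct.rid k X.space (TensorProduct.map LinearMap.id (contractLeft k X.space)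
    (TensorProduct.assoc k X.space (Module.Dual k X.space) X.space
      (coevaluation k X.space 1 ⊗ₜ x))) = x
  rw [coevaluation_apply_one]
  simp only [TensorProduct.sum_tmul, map_sum, TensorProduct.assoc_tmul,
    TensorProduct.map_tmul, contractLeft_apply, LinearMap.id_apply, TensorProduct.rid_tmul]
  exact X.sum_coord_smul x

theorem zigzag_coevRight_evRight_dual :
    (λ_ X.dual).inv ≫ (X.coevRight Q ⊗ₘ 𝟙 X.dual) ≫ (α_ X.dual X X.dual).hom ≫
      (𝟙 X.dual ⊗ₘ X.evRight Q) ≫ (ρ_ X.dual).hom = 𝟙 X.dual := by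
  refine hom_ext_linear (LinearMap.ext fun (f : Module.Dual k X.space) => ?_)
  change TensorProduct.rid k (Module.Dual k X.space)
    (TensorProduct.map LinearMap.id (X.evRightMap Q)
      (TensorProduct.assoc k (Module.Dual k X.space) X.space (Module.Dual k X.space)
        (X.coevRightMap Q 1 ⊗ₜ f))) = f
  rw [coevRightMap_one]
  simp only [TensorProduct.sum_tmul, map_sum, TensorProduct.assoc_tmul, TensorProduct.map_tmul,
    evRightMap_tmul, act_pivot_pivotInv, LinearMap.id_apply, TensorProduct.rid_tmul]
  exact X.sum_smul_coord f

/-- The right-handed curl on `+` acts by the twist. -/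
theorem curl_coev_evRight :
    (ρ_ X).inv ≫ (𝟙 X ⊗ₘ X.coev) ≫ (α_ X X X.dual).inv ≫ ((braid Q X X).hom ⊗ₘ 𝟙 X.dual) ≫
      (α_ X X X.dual).hom ≫ (𝟙 X ⊗ₘ X.evRight Q) ≫ (ρ_ X).hom = twist Q X := by
  obtain ⟨n, a, b, hR⟩ := TensorProduct.exists_sum_tmul_eq (Q.R : H ⊗[k] H)
  refine hom_ext_linear (LinearMap.ext fun x => ?_)
  change TensorProduct.rid k X.space (TensorProduct.map LinearMap.id (X.evRightMap Q)
    (TensorProduct.assoc k X.space X.space (Module.Dual k X.space)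
      (TensorProduct.map (braidMap Q X.act X.act) LinearMap.id
        ((TensorProduct.assoc k X.space X.space (Module.Dual k X.space)).symm
          (x ⊗ₜ coevaluation k X.space 1))))) = X.act (↑(Q.v⁻¹) : H) x
  -- Summing over the basis closes the loop and leaves `∑ bⱼ g aⱼ`, so `v⁻¹` is expanded in this
  -- form first. The other curls follow the same pattern.
  rw [coevaluation_apply_one, ← Q.sum_mul_pivot_mul hR]
  simp only [TensorProduct.tmul_sum, TensorProduct.sum_tmul, map_sum,
    TensorProduct.assoc_symm_tmul, TensorProduct.assoc_tmul, TensorProduct.map_tmul,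
    braidMap_tmul Q hR, evRightMap_tmul, LinearMap.id_apply, TensorProduct.rid_tmul]
  rw [Finset.sum_comm]
  simp only [← map_smul, ← map_sum, X.sum_coord_smul, LinearMap.sum_apply, map_mul,
    Module.End.mul_apply]

theorem curl_coevRight_ev :
    (λ_ X).inv ≫ (X.coevRight Q ⊗ₘ 𝟙 X) ≫ (α_ X.dual X X).hom ≫
      (𝟙 X.dual ⊗ₘ (braid Q X X).hom) ≫ (α_ X.dual X X).inv ≫ (X.ev ⊗ₘ 𝟙 X) ≫ (λ_ X).hom =
    twist Q X := by
  obtain ⟨n, a, b, hR⟩ := TensorProduct.exists_sum_tmul_eq (Q.R : H ⊗[k] H)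
  refine hom_ext_linear (LinearMap.ext fun x => ?_)
  change TensorProduct.lid k X.space (TensorProduct.map (contractLeft k X.space) LinearMap.id
    ((TensorProduct.assoc k (Module.Dual k X.space) X.space X.space).symm
      (TensorProduct.map LinearMap.id (braidMap Q X.act X.act)
        (TensorProduct.assoc k (Module.Dual k X.space) X.space X.space
          (X.coevRightMap Q 1 ⊗ₜ x))))) = X.act (↑(Q.v⁻¹) : H) x
  rw [coevRightMap_one, ← Q.sum_mul_pivotInv_mul hR]
  simp only [TensorProduct.tmul_sum, TensorProduct.sum_tmul, map_sum,
    TensorProduct.assoc_symm_tmul, TensorProduct.assoc_tmul, TensorProduct.map_tmul,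
    braidMap_tmul Q hR, contractLeft_apply, LinearMap.id_apply, TensorProduct.lid_tmul]
  rw [Finset.sum_comm]
  simp only [← map_smul, ← map_sum, X.sum_coord_smul, LinearMap.sum_apply, map_mul,
    Module.End.mul_apply]

theorem sum_apply_smul_dualAct_coord (f : Module.Dual k X.space) (A : Module.End k X.space)
    (h : H) : ∑ i, f (A (X.basis i)) • dualAct X.act h (X.basis.coord i) =
      f ∘ₗ A ∘ₗ X.act (HopfAlgebra.antipode k h) := by
  simp only [← map_smul, ← map_sum]
  exact congrArg (dualAct X.act h) (X.sum_smul_coord (f ∘ₗ A))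

theorem antipode_v_inv : HopfAlgebra.antipode k (↑(Q.v⁻¹) : H) = (↑(Q.v⁻¹) : H) := by
  have h : HopfAlgebra.antipode k ((Q.v : H) * (↑(Q.v⁻¹) : H)) = 1 := by
    rw [Units.mul_inv, HopfAlgebra.antipode_one]
  rw [HopfAlgebra.antipode_mul_antidistrib, Q.antipode_v] at h
  exact (Units.inv_eq_of_mul_eq_one_left h).symm

/-- The action on the dual involves `S(v⁻¹)`, which is `v⁻¹` because `S(v) = v`. -/
theorem twist_dual_apply (f : Module.Dual k X.space) :
    (twist Q X.dual).map.hom f = f ∘ₗ X.act (↑(Q.v⁻¹) : H) := by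
  refine LinearMap.ext fun x => ?_
  change f (X.act (HopfAlgebra.antipode k (↑(Q.v⁻¹) : H)) x) = f (X.act (↑(Q.v⁻¹) : H) x)
  rw [antipode_v_inv]

theorem curl_coevRight_ev_dual :
    (ρ_ X.dual).inv ≫ (𝟙 X.dual ⊗ₘ X.coevRight Q) ≫ (α_ X.dual X.dual X).inv ≫
      ((braid Q X.dual X.dual).hom ⊗ₘ 𝟙 X) ≫ (α_ X.dual X.dual X).hom ≫ (𝟙 X.dual ⊗ₘ X.ev) ≫
      (ρ_ X.dual).hom = twist Q X.dual := by
  obtain ⟨n, a, b, hR⟩ := TensorProduct.exists_sum_tmul_eq (Q.R : H ⊗[k] H)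
  refine hom_ext_linear (LinearMap.ext fun (f : Module.Dual k X.space) => ?_)
  refine Eq.trans ?_ (X.twist_dual_apply Q f).symm
  change TensorProduct.rid k (Module.Dual k X.space)
    (TensorProduct.map LinearMap.id (contractLeft k X.space)
      (TensorProduct.assoc k (Module.Dual k X.space) (Module.Dual k X.space) X.space
        (TensorProduct.map (braidMap Q (dualAct X.act) (dualAct X.act)) LinearMap.id
          ((TensorProduct.assoc k (Module.Dual k X.space) (Module.Dual k X.space) X.space).symm
            (f ⊗ₜ X.coevRightMap Q 1))))) = f ∘ₗ X.act (↑(Q.v⁻¹) : H)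
  rw [coevRightMap_one, ← Q.sum_antipode_mul_pivotInv_mul hR]
  simp only [TensorProduct.tmul_sum, TensorProduct.sum_tmul, map_sum,
    TensorProduct.assoc_symm_tmul, TensorProduct.assoc_tmul, TensorProduct.map_tmul,
    braidMap_tmul Q hR, contractLeft_apply, LinearMap.id_apply, TensorProduct.rid_tmul,
    dualAct_apply]
  rw [Finset.sum_comm]
  refine (Finset.sum_congr rfl fun j _ => X.sum_apply_smul_dualAct_coord f
    (X.act (HopfAlgebra.antipode k (a j)) * X.act Q.pivotInv) (b j)).trans ?_
  ext x
  simp only [LinearMap.sum_apply, LinearMap.comp_apply, Module.End.mul_apply, map_mul, map_sum]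

theorem curl_coev_evRight_dual :
    (λ_ X.dual).inv ≫ (X.coev ⊗ₘ 𝟙 X.dual) ≫ (α_ X X.dual X.dual).hom ≫
      (𝟙 X ⊗ₘ (braid Q X.dual X.dual).hom) ≫ (α_ X X.dual X.dual).inv ≫
      (X.evRight Q ⊗ₘ 𝟙 X.dual) ≫ (λ_ X.dual).hom = twist Q X.dual := by
  obtain ⟨n, a, b, hR⟩ := TensorProduct.exists_sum_tmul_eq (Q.R : H ⊗[k] H)
  refine hom_ext_linear (LinearMap.ext fun (f : Module.Dual k X.space) => ?_)
  refine Eq.trans ?_ (X.twist_dual_apply Q f).symm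
  change TensorProduct.lid k (Module.Dual k X.space)
    (TensorProduct.map (X.evRightMap Q) LinearMap.id
      ((TensorProduct.assoc k X.space (Module.Dual k X.space) (Module.Dual k X.space)).symm
        (TensorProduct.map LinearMap.id (braidMap Q (dualAct X.act) (dualAct X.act))
          (TensorProduct.assoc k X.space (Module.Dual k X.space) (Module.Dual k X.space)
            (coevaluation k X.space 1 ⊗ₜ f))))) = f ∘ₗ X.act (↑(Q.v⁻¹) : H)
  rw [coevaluation_apply_one, ← Q.sum_antipode_mul_pivot_mul hR]
  simp only [TensorProduct.tmul_sum, TensorProduct.sum_tmul, map_sum,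
    TensorProduct.assoc_symm_tmul, TensorProduct.assoc_tmul, TensorProduct.map_tmul,
    braidMap_tmul Q hR, evRightMap_tmul, LinearMap.id_apply, TensorProduct.lid_tmul,
    dualAct_apply]
  rw [Finset.sum_comm]
  refine (Finset.sum_congr rfl fun j _ => X.sum_apply_smul_dualAct_coord f
    (X.act (HopfAlgebra.antipode k (b j)) * X.act Q.pivot) (a j)).trans ?_
  ext x
  simp only [LinearMap.sum_apply, LinearMap.comp_apply, Module.End.mul_apply, map_mul, map_sum]

end FDHMod
end Moves

/-! ### Invariance on classical tangles and comparison with vector spaces -/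

noncomputable section Invariance

variable {k : Type u} {H : Type w} [Field k] [Ring H] [HopfAlgebra k H]

open FDHMod

/-- The Reshetikhin–Turaev functor respects the generating moves of framed tangles. -/
theorem reshetikhinTuraev_move (Q : RibbonStructure k H) (X : FDHMod.{u, w} k H)
    {A B : TangleWord} {f g : TangleDiagram ClassicalPiece A B} (h : FramedMove A B f g) :
    reshetikhinTuraev Q X f = reshetikhinTuraev Q X g := by
  -- The braiding depends on the chosen `Q`, so it is made an instance only here.
  let _ := braided Q
  cases h with
  | zigzag_left a b h =>
    cases a <;> cases b
    · exact absurd rfl h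
    · exact X.zigzag_coevRight_evRight Q
    · exact X.zigzag_coev_ev_dual
    · exact absurd rfl h
  | zigzag_right a b h =>
    cases a <;> cases b
    · exact absurd rfl h
    · exact X.zigzag_coev_ev
    · exact X.zigzag_coevRight_evRight_dual Q
    · exact absurd rfl h
  | cap_slide_over a b c h =>
    exact braiding_cap_slide_over (colour X c) (ribbonPiece Q X (.cap a b h))
  | cap_slide_under a b c h =>
    exact braiding_cap_slide_under (colour X c) (ribbonPiece Q X (.cap a b h))
  | cup_slide_over a b c h =>
    exact braiding_cup_slide_over (colour X c) (ribbonPiece Q X (.cup a b h))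
  | cup_slide_under a b c h =>
    exact braiding_cup_slide_under (colour X c) (ribbonPiece Q X (.cup a b h))
  | reidemeister₁ a b h =>
    cases a <;> cases b
    · exact absurd rfl h
    · exact (X.curl_coev_evRight Q).trans (X.curl_coevRight_ev Q).symm
    · exact (X.curl_coevRight_ev_dual Q).trans (X.curl_coev_evRight_dual Q).symm
    · exact absurd rfl h
  | reidemeister₂_over_under a b => exact (braid Q (colour X a) (colour X b)).hom_inv_id
  | reidemeister₂_under_over a b => exact (braid Q (colour X b) (colour X a)).inv_hom_id
  | reidemeister₃ a b c => exact braiding_triple (colour X a) (colour X b) (colour X c)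

/-- The vector space underlying the module attached to a word. -/
def wordIso (X : FDHMod.{u, w} k H) : ∀ A : TangleWord,
    FDHMod.forget.obj (A.obj (colour X)) ≅ A.obj (colourSpace X)
  | .unit => Iso.refl _
  | .letter _ => Iso.refl _
  | .tensor A B => wordIso X A ⊗ᵢ wordIso X B

theorem wordIso_letter_tensor (X : FDHMod.{u, w} k H) (a b : OrientationSign) :
    (wordIso X (.tensor (.letter a) (.letter b))).hom = 𝟙 _ :=
  id_tensorHom_id _ _

/-- Each elementary piece has at most two ends on either side, and for such words the comparison
isomorphism is the identity. -/
theorem virtualPiece_classical (Q : RibbonStructure k H) (X : FDHMod.{u, w} k H)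
    {A B : TangleWord} (p : ClassicalPiece A B) :
    FDHMod.forget.map (ribbonPiece Q X p) ≫ (wordIso X B).hom =
      (wordIso X A).hom ≫ virtualPiece Q X (.classical p) := by
  rcases p with ⟨a, b⟩ | ⟨a, b⟩ | ⟨a, b, h⟩ | ⟨a, b, h⟩
  · rw [wordIso_letter_tensor, wordIso_letter_tensor]
    exact (Category.comp_id _).trans (Category.id_comp _).symm
  · rw [wordIso_letter_tensor, wordIso_letter_tensor]
    exact (Category.comp_id _).trans (Category.id_comp _).symm
  · rw [wordIso_letter_tensor]
    exact (Category.comp_id _).trans (Category.id_comp _).symm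
  · rw [wordIso_letter_tensor]
    exact (Category.comp_id _).trans (Category.id_comp _).symm

/-- On classical diagrams the functor to vector spaces is the Reshetikhin–Turaev functor followed
by the forgetful functor. -/
theorem virtualOperator_toVirtual (Q : RibbonStructure k H) (X : FDHMod.{u, w} k H)
    {A B : TangleWord} (D : TangleDiagram ClassicalPiece A B) :
    FDHMod.forget.map (reshetikhinTuraev Q X D) ≫ (wordIso X B).hom =
      (wordIso X A).hom ≫ virtualOperator Q X D.toVirtual := by
  induction D with
  | piece p => exact virtualPiece_classical Q X p
  | idTangle A => exact (Category.id_comp _).trans (Category.comp_id _).symm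
  | comp f g ihf ihg =>
    change FDHMod.forget.map (reshetikhinTuraev Q X f ≫ reshetikhinTuraev Q X g) ≫ _ =
      _ ≫ virtualOperator Q X f.toVirtual ≫ virtualOperator Q X g.toVirtual
    rw [Functor.map_comp, Category.assoc, ihg, ← Category.assoc, ihf, Category.assoc]
  | tensor f g ihf ihg =>
    change (FDHMod.forget.map (reshetikhinTuraev Q X f) ⊗ₘ
        FDHMod.forget.map (reshetikhinTuraev Q X g)) ≫ ((wordIso X _).hom ⊗ₘ (wordIso X _).hom) =
      ((wordIso X _).hom ⊗ₘ (wordIso X _).hom) ≫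
        (virtualOperator Q X f.toVirtual ⊗ₘ virtualOperator Q X g.toVirtual)
    rw [tensorHom_comp_tensorHom, tensorHom_comp_tensorHom, ihf, ihg]
  | assoc A B C =>
    exact (associator_naturality (wordIso X A).hom (wordIso X B).hom (wordIso X C).hom).symm
  | assocInv A B C =>
    exact (associator_inv_naturality (wordIso X A).hom (wordIso X B).hom (wordIso X C).hom).symm
  | leftUnit A =>
    exact ((congrArg (· ≫ (λ_ _).hom) (id_tensorHom _ (wordIso X A).hom)).trans
      (leftUnitor_naturality (wordIso X A).hom)).symm
  | leftUnitInv A =>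
    exact ((leftUnitor_inv_naturality (wordIso X A).hom).trans
      (congrArg ((λ_ _).inv ≫ ·) (id_tensorHom _ (wordIso X A).hom).symm)).symm
  | rightUnit A =>
    exact ((congrArg (· ≫ (ρ_ _).hom) (tensorHom_id (wordIso X A).hom _)).trans
      (rightUnitor_naturality (wordIso X A).hom)).symm
  | rightUnitInv A =>
    exact ((rightUnitor_inv_naturality (wordIso X A).hom).trans
      (congrArg ((ρ_ _).inv ≫ ·) (tensorHom_id (wordIso X A).hom _).symm)).symm

end Invariance

/-! ### The mixed move in a symmetric category -/

section Symmetric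

variable {C : Type*} [Category C] [MonoidalCategory C] [SymmetricCategory C]

/-- The strand `b` slides past `f` by naturality of the braiding of `b`, with no condition on `f`.
Crossing `a` with `b` at both ends then cancels by symmetry, which puts the crossings in the
required order. -/
theorem symmetry_triple {a c : C} (b : C) (f : a ⊗ c ⟶ c ⊗ a) :
    ((β_ a b).hom ⊗ₘ 𝟙 c) ≫ (α_ b a c).hom ≫ (𝟙 b ⊗ₘ f) ≫ (α_ b c a).inv ≫
        ((β_ b c).hom ⊗ₘ 𝟙 a) =
      (α_ a b c).hom ≫ (𝟙 a ⊗ₘ (β_ b c).hom) ≫ (α_ a c b).inv ≫ (f ⊗ₘ 𝟙 b) ≫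
        (α_ c a b).hom ≫ (𝟙 c ⊗ₘ (β_ a b).hom) ≫ (α_ c b a).inv := by
  have h := BraidedCategory.braiding_naturality_right b f
  have h' := ((β_ a b).hom ▷ c ≫ (α_ b a c).hom) ≫= h =≫
    ((α_ c a b).hom ≫ c ◁ (β_ a b).hom ≫ (α_ c b a).inv)
  simpa [← comp_whiskerRight_assoc, ← MonoidalCategory.whiskerLeft_comp_assoc] using h'

end Symmetric

/-! ### Invariance on virtual tangles and restriction to classical links -/

section VirtualInvariance

variable {k : Type u} {H : Type w} [Field k] [Ring H] [HopfAlgebra k H]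

/-- The functor to vector spaces respects the generating moves of framed virtual tangles. -/
theorem virtualOperator_move (Q : RibbonStructure k H) (X : FDHMod.{u, w} k H)
    {A B : TangleWord} {f g : TangleDiagram VirtualPiece A B} (h : VirtualMove A B f g) :
    virtualOperator Q X f = virtualOperator Q X g := by
  cases h with
  | @classical _ _ f g h =>
    -- After composition with the comparison isomorphism, both sides are images of `H`-linear
    -- evaluations, which agree.
    rw [← cancel_epi (wordIso X A).hom, ← virtualOperator_toVirtual, ← virtualOperator_toVirtual,
      reshetikhinTuraev_move Q X h]
  | cap_slide a b c h =>
    -- The flip is its own inverse, so one virtual crossing plays both the direct and the inverse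
    -- braiding of the general slide.
    refine Eq.trans ?_ (braiding_cap_slide_under (colourSpace X c)
      (virtualPiece Q X (.classical (.cap a b h))))
    rw [← SymmetricCategory.braiding_swap_eq_inv_braiding]
    rfl
  | cup_slide a b c h =>
    refine Eq.trans ?_ (braiding_cup_slide_over (colourSpace X c)
      (virtualPiece Q X (.classical (.cup a b h))))
    rw [← SymmetricCategory.braiding_swap_eq_inv_braiding]
    rfl
  | virtual₂ a b => exact SymmetricCategory.symmetry (colourSpace X a) (colourSpace X b)
  | virtual₃ a b c => exact braiding_triple (colourSpace X a) (colourSpace X b) (colourSpace X c)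
  | mixed a b c =>
    exact symmetry_triple (colourSpace X b) (virtualPiece Q X (.classical (.over a c)))

theorem virtualInvariant_toVirtual (Q : RibbonStructure k H) (X : FDHMod.{u, w} k H)
    (D : LinkDiagram) :
    virtualInvariant Q X D.toVirtual = reshetikhinTuraevInvariant Q X D := by
  have h := virtualOperator_toVirtual Q X D
  -- On the empty word the comparison isomorphism is the identity of `k`.
  have h' : virtualOperator Q X D.toVirtual = FDHMod.forget.map (reshetikhinTuraev Q X D) :=
    ((Category.comp_id _).symm.trans (h.trans (Category.id_comp _))).symm
  rw [virtualInvariant, h']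
  rfl

end VirtualInvariance

theorem proposition4p2 {k : Type u} [Field k] {H : Type w} [Ring H] [HopfAlgebra k H]
    (Q : RibbonStructure k H) (V : Type u) [AddCommGroup V] [Module k V] [Module H V]
    [IsScalarTower k H V] [FiniteDimensional k V] :
    ∃ (Z : FramedVirtualLink → k) (J : FramedLink → k),
      (∀ D : VirtualLinkDiagram,
        Z (FramedVirtualLink.mk D) = virtualInvariant Q (FDHMod.ofModule k H V) D) ∧
      (∀ D : LinkDiagram,
        J (FramedLink.mk D) = reshetikhinTuraevInvariant Q (FDHMod.ofModule k H V) D) ∧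
      ∀ L : FramedLink, Z L.toVirtual = J L := by
  let X := FDHMod.ofModule k H V
  refine ⟨Quot.lift (virtualInvariant Q X) fun D D' h => ?_,
    Quot.lift (reshetikhinTuraevInvariant Q X) fun D D' h => ?_, fun _ => rfl, fun _ => rfl, ?_⟩
  · have e : virtualOperator Q X D = virtualOperator Q X D' :=
      h.eval_eq _ _ (virtualOperator_move Q X)
    rw [virtualInvariant, e, virtualInvariant]
  · have e : reshetikhinTuraev Q X D = reshetikhinTuraev Q X D' :=
      h.eval_eq _ _ (reshetikhinTuraev_move Q X)
    rw [reshetikhinTuraevInvariant, e, reshetikhinTuraevInvariant]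
  · rintro ⟨D⟩
    exact virtualInvariant_toVirtual Q X D
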